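/- Let $\mathscr A$ be a nonempty set (the alphabet), let $X\subseteq\mathscr A^{\mathbb N}$ be a subshift, i.e. for some set $F$ of finite words, $X$ is the set of all sequences having no word in $F$, and assume that every letter of $\mathscr A$ occurs in some element of $X$. Let $\mathcal L_X$ be the set of finite words (including the empty word $\omega$) occurring in elements of $X$; for $\alpha,\beta\in\mathcal L_X$ put $C(\alpha,\beta)=\{\beta x\in X:\alpha x\in X\}$, and let $\mathcal U$ be the Boolean algebra of subsets of $X$ generated by all the sets $C(\alpha,\beta)$. Let $R$ be a field, and let $\widetilde{\mathcal A}_R(X)$ be the unital subshift algebra: the universal unital $R$-algebra with generators $p_A$ ($A\in\mathcal U$) and $s_a,s_a^*$ ($a\in\mathscr A$) subject to the relations 1. $p_X=1$, $p_\emptyset=0$, $p_{A\cap B}=p_Ap_B$ and $p_{A\cup B}=p_A+p_B-p_{A\cap B}$ for all $A,B\in\mathcal U$; 2. $s_as_a^*s_a=s_a$ and $s_a^*s_as_a^*=s_a^*$ for all $a\in\mathscr A$; 3. $s_\beta s_\alpha^*s_\alpha s_\beta^*=p_{C(\alpha,\beta)}$ for all $\alpha,\beta\in\mathcal L_X$,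 where $s_\omega=s_\omega^*=1$, and $s_\alpha=s_{\alpha_1}\cdots s_{\alpha_n}$, $s_\alpha^*=s_{\alpha_n}^*\cdots s_{\alpha_1}^*$ for $\alpha=\alpha_1\cdots\alpha_n$. Let $\mathcal Q_X$ be the set of all one-point sets $\{p\}\in\mathcal U$ such that $p\neq\alpha\beta^\infty$ for all $\alpha,\beta\in\mathcal L_X$ with $\beta\neq\omega$. Let the socle $\mathrm{Soc}(\widetilde{\mathcal A}_R(X))$ be the sum of all minimal left ideals of $\widetilde{\mathcal A}_R(X)$. Then: (a) $\mathrm{Soc}(\widetilde{\mathcal A}_R(X))$ is the two-sided ideal of $\widetilde{\mathcal A}_R(X)$ generated by $\{p_A:A\in\mathcal Q_X\}$. (b) The subspaces $\widetilde{\mathcal A}_R(X)_n=\operatorname{span}_R\{s_\alpha p_As_\beta^*:\alpha,\beta\in\mathcal L_X,\ A\in\mathcal U,\ |\alpha|-|\beta|=n\}$, $n\in\mathbb Z$, form a $\mathbb Z$-grading of $\widetilde{\mathcal A}_R(X)$, and $\mathrm{Soc}(\widetilde{\mathcal A}_R(X))$ is a graded ideal for it. (c) $\mathrm{Soc}(\widetilde{\mathcal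 A}_R(X))\neq 0$ if and only if $\mathcal Q_X\neq\emptyset$. (d) $\mathrm{Soc}(\widetilde{\mathcal A}_R(X))\neq\widetilde{\mathcal A}_R(X)$. -/

import Mathlib

universe u v

namespace Subshift

variable {𝒜 : Type u}

/-- The set of sequences over the alphabet `𝒜` none of whose words (finite blocks of consecutive
letters) belongs to the set `F` of forbidden words. -/
def avoiding (F : Set (List 𝒜)) : Set (Stream' 𝒜) :=
  {x | ∀ k n : ℕ, (x.drop k).take n ∉ F}

/-- A subshift over `𝒜` is a set of sequences given by some set of forbidden words. -/
def IsSubshift (X : Set (Stream' 𝒜)) : Prop :=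
  ∃ F : Set (List 𝒜), X = avoiding F

/-- The language of `X`: all words `x₀ … xₙ₋₁` with `x ∈ X` (for a shift-invariant `X` these are
all the words that occur in some element of `X`). -/
def language (X : Set (Stream' 𝒜)) : Set (List 𝒜) :=
  {w | ∃ x ∈ X, x.take w.length = w}

/-- The set `C(α, β) = {βx ∈ X : αx ∈ X}`, as a subset of `X`. -/
def relCylinder (X : Set (Stream' 𝒜)) (α β : List 𝒜) : Set X :=
  {z | ∃ x : Stream' 𝒜, (z : Stream' 𝒜) = β ++ₛ x ∧ α ++ₛ x ∈ X}

/-- The Boolean algebra `𝒰` of subsets of `X` generated by all `C(α, β)`, for `α, β` in the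
language of `X`. -/
def boolAlg (X : Set (Stream' 𝒜)) : BooleanSubalgebra (Set X) :=
  BooleanSubalgebra.closure
    {C | ∃ α ∈ language X, ∃ β ∈ language X, C = relCylinder X α β}

/-- For `α, β` in the language of `X`, the set `C(α, β)` as an element of `𝒰`. -/
def relCylinderMem (X : Set (Stream' 𝒜)) (α β : language X) : boolAlg X :=
  ⟨relCylinder X α β,
    BooleanSubalgebra.subset_closure ⟨α, α.2, β, β.2, rfl⟩⟩

/-- The generators of the unital subshift algebra: `p_A` for `A ∈ 𝒰`, and `s_a`, `s_a^*` for each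
letter `a`. -/
inductive Gen (X : Set (Stream' 𝒜)) : Type u
  | p (A : boolAlg X) : Gen X
  | s (a : 𝒜) : Gen X
  | sStar (a : 𝒜) : Gen X

section Free

variable (R : Type v) [CommRing R] (X : Set (Stream' 𝒜))

/-- The generator `p_A` in the free algebra. -/
def freeP (A : boolAlg X) : FreeAlgebra R (Gen X) := FreeAlgebra.ι R (Gen.p A)

/-- The element `s_α = s_{α₁} ⋯ s_{αₙ}` of the free algebra (it is `1` for the empty word). -/
def freeS (α : List 𝒜) : FreeAlgebra R (Gen X) :=
  (α.map fun a => FreeAlgebra.ι R (Gen.s a)).prod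

/-- The element `s_α^* = s_{αₙ}^* ⋯ s_{α₁}^*` of the free algebra (it is `1` for the empty
word). -/
def freeSStar (α : List 𝒜) : FreeAlgebra R (Gen X) :=
  (α.reverse.map fun a => FreeAlgebra.ι R (Gen.sStar a)).prod

/-- The defining relations of the unital subshift algebra. -/
inductive Rel : FreeAlgebra R (Gen X) → FreeAlgebra R (Gen X) → Prop
  | p_top : Rel (freeP R X ⊤) 1
  | p_bot : Rel (freeP R X ⊥) 0
  | p_inf (A B : boolAlg X) : Rel (freeP R X (A ⊓ B)) (freeP R X A * freeP R X B)
  | p_sup (A B : boolAlg X) :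
      Rel (freeP R X (A ⊔ B)) (freeP R X A + freeP R X B - freeP R X (A ⊓ B))
  | s_sStar_s (a : 𝒜) :
      Rel (freeS R X [a] * freeSStar R X [a] * freeS R X [a]) (freeS R X [a])
  | sStar_s_sStar (a : 𝒜) :
      Rel (freeSStar R X [a] * freeS R X [a] * freeSStar R X [a]) (freeSStar R X [a])
  | cylinder (α β : language X) :
      Rel (freeS R X β * freeSStar R X α * freeS R X α * freeSStar R X β)
        (freeP R X (relCylinderMem X α β))

end Free

/-- The unital subshift algebra of `X` over `R`: the universal unital `R`-algebra on the generators
`Gen X` subject to the relations `Rel R X`. -/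
def UnitalAlgebra (R : Type v) [CommRing R] (X : Set (Stream' 𝒜)) : Type (max u v) :=
  RingQuot (Rel R X)

section Quot

variable (R : Type v) [CommRing R] (X : Set (Stream' 𝒜))

instance instRingUnitalAlgebra : Ring (UnitalAlgebra R X) :=
  inferInstanceAs (Ring (RingQuot (Rel R X)))

instance instAlgebraUnitalAlgebra : Algebra R (UnitalAlgebra R X) :=
  inferInstanceAs (Algebra R (RingQuot (Rel R X)))

/-- The quotient map from the free algebra. -/
def UnitalAlgebra.mk : FreeAlgebra R (Gen X) →ₐ[R] UnitalAlgebra R X :=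
  RingQuot.mkAlgHom R (Rel R X)

/-- The element `p_A` of the subshift algebra. -/
def UnitalAlgebra.p (A : boolAlg X) : UnitalAlgebra R X := UnitalAlgebra.mk R X (freeP R X A)

/-- The element `s_α` of the subshift algebra. -/
def UnitalAlgebra.s (α : List 𝒜) : UnitalAlgebra R X := UnitalAlgebra.mk R X (freeS R X α)

/-- The element `s_α^*` of the subshift algebra. -/
def UnitalAlgebra.sStar (α : List 𝒜) : UnitalAlgebra R X := UnitalAlgebra.mk R X (freeSStar R X α)

/-- The degree `n` part of the subshift algebra: the `R`-span of all `s_α p_A s_β^*` with `α, β` in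
the language of `X`, `A ∈ 𝒰` and `|α| - |β| = n`. -/
def UnitalAlgebra.degreePart (n : ℤ) : Submodule R (UnitalAlgebra R X) :=
  Submodule.span R
    {x | ∃ α ∈ language X, ∃ β ∈ language X, ∃ A : boolAlg X,
      (α.length : ℤ) - (β.length : ℤ) = n ∧
        x = UnitalAlgebra.s R X α * UnitalAlgebra.p R X A * UnitalAlgebra.sStar R X β}

end Quot

/-- The set `𝒬_X` of irrational paths: all one-point sets `{p} ∈ 𝒰` such that `p` is not of the
form `αβ^∞` with `α, β` in the language of `X`, `β` nonempty. -/
def irrationalPaths (X : Set (Stream' 𝒜)) : Set (boolAlg X) :=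
  {A | ∃ p : X, (A : Set X) = {p} ∧
    ∀ α ∈ language X, ∀ β ∈ language X, ∀ hβ : β ≠ [],
      (p : Stream' 𝒜) ≠ α ++ₛ Stream'.cycle β hβ}

end Subshift

/-- The (left) socle of a ring: the sum of all its minimal left ideals. (For a noncommutative ring
`B`, the type `Ideal B` is the lattice of left ideals, and its atoms are the minimal ones.) -/
def leftSocle (B : Type*) [Ring B] : Ideal B :=
  sSup {I : Ideal B | IsAtom I}

/-! Let L be the ring of Laurent polynomials in T over R. The algebra acts on the free L-module with
basis e_x (x ∈ X): s_a sends e_x to T e_{ax} (to 0 if ax ∉ X), s_a^* sends e_{ax} to T⁻¹ e_x, and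
p_A projects onto the e_x with x ∈ A. The commutation rules p_A s_α = s_α p_{α⁻¹A} and s_α^* p_A =
p_{α⁻¹A} s_α^* show that the monomials s_α p_A s_β^* span the algebra. Such a monomial carries the
factor T^{|α|-|β|}, so the powers of T separate the degrees. A homogeneous element of the kernel is
reduced, by factors s_a on the right and s_a^* on the left, to a combination of projections p_A,
where faithfulness is elementary. Hence the representation is faithful (`rep_injective`) and the
grading is direct (`isInternal_degreePart`).

Let {x} ∈ 𝒰 with x not eventually periodic, and let p = p_{{x}}. If bp ≠ 0, some coefficient of b
e_x is nonzero; it sits at a point with a tail in common with x, and can be carried back to x. The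
resulting coefficient lies in R, because no nontrivial power of T can fix such an x; it is therefore
invertible, and p is a left multiple of bp (`exists_mul_mul_p_eq`). So every nonzero pc generates a
minimal left ideal.

Conversely, a minimal left ideal I contains some b with b e_w = f e_z and f ≠ 0. Minimality gives: c
e_z = 0 implies cb = 0 (`mul_eq_zero_of_rep_eq_zero`). If z were eventually periodic, some T^k - 1
with k ≠ 0 would have to be a unit of L (`isIrrational_of_isAtom`). Comparing the coefficients of b
with their local constancy shows {z} ∈ 𝒰 (`exists_singleton_of_isAtom`). Then b = p_{{z}} b, and I
lies in the ideal generated by the p_A.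

Homogeneity follows from homogeneous generators. The socle is proper because its elements have image
in a finitely generated submodule, while an irrational point forces X to be infinite. -/

namespace Subshift

/-! ### Closure of the Boolean algebra under adding and removing prefixes -/

section Sets

variable {𝒜 : Type u} {X : Set (Stream' 𝒜)}

/-- The standing assumptions on the set `X` of sequences: it is invariant under the shift, its
language contains all letters and (so that it is nonempty) the empty word. -/
structure Admissible (X : Set (Stream' 𝒜)) : Prop where
  tail_mem : ∀ x ∈ X, x.tail ∈ X
  letter_mem : ∀ a : 𝒜, [a] ∈ language X
  nil_mem : [] ∈ language X

theorem IsSubshift.admissible [Nonempty 𝒜] (hX : IsSubshift X)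
    (hl : ∀ a : 𝒜, [a] ∈ language X) : Admissible X where
  tail_mem := by
    obtain ⟨F, rfl⟩ := hX
    intro x hx k n
    have := hx (k + 1) n
    rwa [Stream'.drop_succ] at this
  letter_mem := hl
  nil_mem := by
    obtain ⟨x, hx, -⟩ := hl (Classical.arbitrary 𝒜)
    exact ⟨x, hx, rfl⟩

theorem take_length_append (α : List 𝒜) (x : Stream' 𝒜) : (α ++ₛ x).take α.length = α := by
  have := Stream'.append_take 0 α x
  simpa using this.symm

theorem mem_language_of_append_mem {α : List 𝒜} {x : Stream' 𝒜} (h : α ++ₛ x ∈ X) :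
    α ∈ language X :=
  ⟨_, h, take_length_append α x⟩

theorem take_mem_language {x : Stream' 𝒜} (h : x ∈ X) (n : ℕ) : x.take n ∈ language X :=
  ⟨x, h, by rw [Stream'.length_take]⟩

theorem exists_append_mem {α : List 𝒜} (h : α ∈ language X) : ∃ x, α ++ₛ x ∈ X := by
  obtain ⟨x, hx, h⟩ := h
  refine ⟨x.drop α.length, ?_⟩
  nth_rewrite 1 [← h]
  rwa [Stream'.append_take_drop]

namespace Admissible

variable (hX : Admissible X)
include hX

theorem drop_mem {x : Stream' 𝒜} (hx : x ∈ X) (n : ℕ) : x.drop n ∈ X := by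
  induction n generalizing x with
  | zero => exact hx
  | succ n ih => rw [Stream'.drop_succ]; exact ih (hX.tail_mem x hx)

theorem mem_of_append {α : List 𝒜} {x : Stream' 𝒜} (h : α ++ₛ x ∈ X) : x ∈ X := by
  have := hX.drop_mem h α.length
  rwa [Stream'.drop_append_stream] at this

theorem mem_of_cons {a : 𝒜} {x : Stream' 𝒜} (h : Stream'.cons a x ∈ X) : x ∈ X :=
  hX.tail_mem _ h

theorem language_of_append {α β : List 𝒜} (h : α ++ β ∈ language X) : β ∈ language X := by
  obtain ⟨x, hx⟩ := exists_append_mem h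
  rw [Stream'.append_append_stream] at hx
  exact mem_language_of_append_mem (hX.mem_of_append hx)

end Admissible

/-- The set `{x ∈ X : αx ∈ A}`. -/
def pre (α : List 𝒜) (A : Set X) : Set X :=
  {x | ∃ h : α ++ₛ (x : Stream' 𝒜) ∈ X, ⟨α ++ₛ (x : Stream' 𝒜), h⟩ ∈ A}

/-- The set `{αx ∈ X : x ∈ A}`. -/
def img (α : List 𝒜) (A : Set X) : Set X :=
  {z | ∃ x ∈ A, (z : Stream' 𝒜) = α ++ₛ (x : Stream' 𝒜)}

theorem pre_nil (A : Set X) : pre [] A = A := by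
  ext x; simp [pre]

theorem img_nil (A : Set X) : img [] A = A := by
  ext x; simp [img, Subtype.coe_inj]

theorem Admissible.pre_append (hX : Admissible X) (α β : List 𝒜) (A : Set X) :
    pre (α ++ β) A = pre β (pre α A) := by
  ext x
  simp only [pre, Set.mem_ofPred_eq, Stream'.append_append_stream]
  exact ⟨fun ⟨h, h'⟩ => ⟨hX.mem_of_append h, h, h'⟩, fun ⟨_, h, h'⟩ => ⟨h, h'⟩⟩

theorem Admissible.img_append (hX : Admissible X) (α β : List 𝒜) (A : Set X) :
    img (α ++ β) A = img α (img β A) := by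
  ext z
  simp only [img, Set.mem_ofPred_eq, Stream'.append_append_stream]
  constructor
  · rintro ⟨x, hx, h⟩
    exact ⟨⟨β ++ₛ x, hX.mem_of_append (α := α) (h ▸ z.2)⟩, ⟨x, hx, rfl⟩, h⟩
  · rintro ⟨y, ⟨x, hx, hy⟩, h⟩
    exact ⟨x, hx, by rw [h, hy]⟩

theorem relCylinder_nil_right (α : List 𝒜) :
    relCylinder X α [] = pre α Set.univ := by
  ext z
  simp [relCylinder, pre]

theorem relCylinder_nil_left (β : List 𝒜) :
    relCylinder X [] β = img β Set.univ := by
  ext z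
  simp only [relCylinder, img, Set.mem_ofPred_eq, Stream'.nil_append_stream, Set.mem_univ, true_and]
  exact ⟨fun ⟨x, h, h'⟩ => ⟨⟨x, h'⟩, h⟩, fun ⟨x, h⟩ => ⟨x, h, x.2⟩⟩

theorem Admissible.mem_img_univ_iff (hX : Admissible X) (β : List 𝒜) (z : X) :
    z ∈ img β Set.univ ↔ (z : Stream' 𝒜).take β.length = β := by
  constructor
  · rintro ⟨x, -, h⟩
    rw [h, take_length_append]
  · intro h
    refine ⟨⟨_, hX.drop_mem z.2 β.length⟩, trivial, ?_⟩
    change (z : Stream' 𝒜) = β ++ₛ (z : Stream' 𝒜).drop β.length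
    conv_rhs => rw [← h, Stream'.length_take, Stream'.append_take_drop]

theorem relCylinder_mem_boolAlg {α β : List 𝒜} (hα : α ∈ language X) (hβ : β ∈ language X) :
    relCylinder X α β ∈ boolAlg X :=
  BooleanSubalgebra.subset_closure ⟨α, hα, β, hβ, rfl⟩

theorem Admissible.pre_univ_mem (hX : Admissible X) (α : List 𝒜) :
    pre α Set.univ ∈ boolAlg X := by
  by_cases h : α ∈ language X
  · rw [← relCylinder_nil_right]
    exact relCylinder_mem_boolAlg h hX.nil_mem
  · have : pre (X := X) α Set.univ = ⊥ := by
      ext x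
      simp only [pre, Set.mem_ofPred_eq, Set.mem_univ, exists_prop, and_true, Set.bot_eq_empty,
        Set.mem_empty_iff_false, iff_false]
      exact fun h' => h (mem_language_of_append_mem h')
    rw [this]
    exact BooleanSubalgebra.bot_mem

theorem Admissible.img_univ_mem (hX : Admissible X) (α : List 𝒜) :
    img α Set.univ ∈ boolAlg X := by
  by_cases h : α ∈ language X
  · rw [← relCylinder_nil_left]
    exact relCylinder_mem_boolAlg hX.nil_mem h
  · have : img (X := X) α Set.univ = ⊥ := by
      ext x
      simp only [img, Set.mem_ofPred_eq, Set.mem_univ, Set.bot_eq_empty,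
        Set.mem_empty_iff_false, iff_false]
      rintro ⟨y, -, hy⟩
      exact h (mem_language_of_append_mem (hy ▸ x.2))
    rw [this]
    exact BooleanSubalgebra.bot_mem

theorem Admissible.pre_singleton_relCylinder (hX : Admissible X) (a : 𝒜) (α : List 𝒜) :
    pre [a] (relCylinder X α []) = pre (α ++ [a]) Set.univ := by
  rw [relCylinder_nil_right, hX.pre_append]

theorem pre_singleton_relCylinder_cons (a : 𝒜) (α β : List 𝒜) :
    pre [a] (relCylinder X α (a :: β)) = pre [a] Set.univ ∩ relCylinder X α β := by
  ext x
  simp only [pre, relCylinder, Set.mem_ofPred_eq, Set.mem_inter_iff, Set.mem_univ, exists_prop,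
    and_true, Stream'.cons_append_stream, Stream'.nil_append_stream,
    Stream'.cons_injective2.eq_iff, true_and]

theorem pre_singleton_relCylinder_cons_of_ne {a b : 𝒜} (h : b ≠ a) (α β : List 𝒜) :
    pre [a] (relCylinder X α (b :: β)) = ∅ := by
  ext x
  simp only [pre, relCylinder, Set.mem_ofPred_eq,
    Stream'.cons_append_stream, Stream'.cons_injective2.eq_iff, Set.mem_empty_iff_false, iff_false]
  rintro ⟨-, y, ⟨h', -⟩, -⟩
  exact h h'.symm

/-- Since αx may fall outside X, complements have to be taken relative to `pre α Set.univ`. -/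
theorem pre_compl (α : List 𝒜) (A : Set X) : pre α Aᶜ = pre α Set.univ \ pre α A := by
  ext x
  simp only [pre, Set.mem_ofPred_eq, Set.mem_sdiff, Set.mem_univ, exists_prop, and_true,
    Set.mem_compl_iff, not_exists]
  exact ⟨fun ⟨h, h'⟩ => ⟨h, fun _ => h'⟩, fun ⟨h, h'⟩ => ⟨h, h' h⟩⟩

theorem pre_union (α : List 𝒜) (A B : Set X) : pre α (A ∪ B) = pre α A ∪ pre α B := by
  ext x
  simp only [pre, Set.mem_ofPred_eq, Set.mem_union]
  exact exists_or

theorem pre_empty (α : List 𝒜) : pre (X := X) α ∅ = ∅ := by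
  ext x
  simp [pre]

theorem img_compl (α : List 𝒜) (A : Set X) : img α Aᶜ = img α Set.univ \ img α A := by
  ext x
  simp only [img, Set.mem_ofPred_eq, Set.mem_sdiff, Set.mem_univ, true_and, Set.mem_compl_iff]
  constructor
  · rintro ⟨y, hy, h⟩
    refine ⟨⟨y, h⟩, ?_⟩
    rintro ⟨y', hy', h'⟩
    rw [h] at h'
    exact hy (by rwa [Subtype.ext (Stream'.append_right_injective _ _ _ h')])
  · rintro ⟨⟨y, h⟩, h'⟩
    exact ⟨y, fun hy => h' ⟨y, hy, h⟩, h⟩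

theorem img_union (α : List 𝒜) (A B : Set X) : img α (A ∪ B) = img α A ∪ img α B := by
  ext x
  simp only [img, Set.mem_ofPred_eq, Set.mem_union, or_and_right, exists_or]

/-- Prefixes can be removed one letter at a time, and removal of a letter is compatible with the
Boolean operations, so only the generators C(α, β) need a computation. -/
theorem Admissible.pre_mem (hX : Admissible X) (α : List 𝒜) {A : Set X} (hA : A ∈ boolAlg X) :
    pre α A ∈ boolAlg X := by
  induction α generalizing A with
  | nil => rwa [pre_nil]
  | cons a α ih =>
    rw [← List.singleton_append, hX.pre_append]
    apply ih
    induction hA using BooleanSubalgebra.closure_bot_sup_induction with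
    | mem C hC =>
      obtain ⟨α, hα, β, hβ, rfl⟩ := hC
      cases β with
      | nil =>
        rw [hX.pre_singleton_relCylinder]
        exact hX.pre_univ_mem _
      | cons b β =>
        by_cases h : b = a
        · subst h
          rw [pre_singleton_relCylinder_cons]
          exact BooleanSubalgebra.infClosed _ (hX.pre_univ_mem _)
            (relCylinder_mem_boolAlg hα (hX.language_of_append (α := [b]) hβ))
        · rw [pre_singleton_relCylinder_cons_of_ne h]
          exact BooleanSubalgebra.bot_mem
    | bot => exact (pre_empty (X := X) [a]).symm ▸ BooleanSubalgebra.bot_mem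
    | sup A hA B hB ihA ihB =>
      exact (pre_union [a] A B).symm ▸ BooleanSubalgebra.supClosed _ ihA ihB
    | compl A hA ih =>
      rw [pre_compl]
      exact BooleanSubalgebra.sdiff_mem (hX.pre_univ_mem _) ih

theorem Admissible.img_mem (hX : Admissible X) (α : List 𝒜) {A : Set X} (hA : A ∈ boolAlg X) :
    img α A ∈ boolAlg X := by
  induction α with
  | nil => rwa [img_nil]
  | cons a α ih =>
    rw [← List.singleton_append, hX.img_append]
    generalize img α A = A at ih
    induction ih using BooleanSubalgebra.closure_bot_sup_induction with
    | mem C hC =>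
      obtain ⟨α, hα, β, hβ, rfl⟩ := hC
      have key : img [a] (relCylinder X α β) = relCylinder X α (a :: β) := by
        ext z
        constructor
        · rintro ⟨y, ⟨x, hx, h⟩, hz⟩
          exact ⟨x, by rw [hz, hx]; rfl, h⟩
        · rintro ⟨x, hx, h⟩
          exact ⟨⟨β ++ₛ x, hX.mem_of_cons (a := a) (by
            rw [← Stream'.cons_append_stream, ← hx]; exact z.2)⟩, ⟨x, rfl, h⟩, hx⟩
      rw [key]
      by_cases h : a :: β ∈ language X
      · exact relCylinder_mem_boolAlg hα h
      · have : relCylinder X α (a :: β) = ⊥ := by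
          ext z
          simp only [relCylinder, Set.mem_ofPred_eq, Set.bot_eq_empty, Set.mem_empty_iff_false,
            iff_false]
          rintro ⟨x, hx, -⟩
          exact h (mem_language_of_append_mem (hx ▸ z.2))
        rw [this]
        exact BooleanSubalgebra.bot_mem
    | bot =>
      have : img (X := X) [a] ⊥ = ⊥ := by ext x; simp [img]
      rw [this]
      exact BooleanSubalgebra.bot_mem
    | sup A hA B hB ihA ihB =>
      exact (img_union [a] A B).symm ▸ BooleanSubalgebra.supClosed _ ihA ihB
    | compl A hA ih =>
      rw [img_compl]
      exact BooleanSubalgebra.sdiff_mem (hX.img_univ_mem _) ih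

/-- The set `{x ∈ X : αx ∈ A}` as an element of `𝒰`. -/
def Admissible.preMem (hX : Admissible X) (α : List 𝒜) (A : boolAlg X) : boolAlg X :=
  ⟨pre α A, hX.pre_mem α A.2⟩

/-- The set `{αx ∈ X : x ∈ A}` as an element of `𝒰`. -/
def Admissible.imgMem (hX : Admissible X) (α : List 𝒜) (A : boolAlg X) : boolAlg X :=
  ⟨img α A, hX.img_mem α A.2⟩

end Sets
end Subshift

/-! ### Commutation rules in the algebra -/

namespace Subshift

namespace UnitalAlgebra

section Relations

variable {𝒜 : Type u} {R : Type v} [CommRing R] {X : Set (Stream' 𝒜)}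

theorem p_top : p R X ⊤ = 1 :=
  (RingQuot.mkAlgHom_rel R Rel.p_top).trans (map_one (mk R X))

theorem p_bot : p R X ⊥ = 0 :=
  (RingQuot.mkAlgHom_rel R Rel.p_bot).trans (map_zero (mk R X))

theorem p_inf (A B : boolAlg X) : p R X (A ⊓ B) = p R X A * p R X B :=
  (RingQuot.mkAlgHom_rel R (Rel.p_inf A B)).trans (map_mul (mk R X) _ _)

theorem p_sup (A B : boolAlg X) : p R X (A ⊔ B) = p R X A + p R X B - p R X (A ⊓ B) := by
  have h : mk R X _ = mk R X _ := RingQuot.mkAlgHom_rel R (Rel.p_sup A B)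
  simp only [map_sub, map_add] at h
  exact h

theorem p_compl (A : boolAlg X) : p R X Aᶜ = 1 - p R X A := by
  have h := p_sup (R := R) A Aᶜ
  rw [sup_compl_eq_top, inf_compl_eq_bot, p_top, p_bot, sub_zero] at h
  rw [h, add_sub_cancel_left]

theorem p_comm (A B : boolAlg X) : p R X A * p R X B = p R X B * p R X A := by
  rw [← p_inf, inf_comm, p_inf]

theorem p_mul_of_le {A B : boolAlg X} (h : A ≤ B) : p R X A * p R X B = p R X A := by
  rw [← p_inf, inf_eq_left.2 h]

theorem s_nil : s R X [] = 1 := by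
  simp [s, freeS]

theorem sStar_nil : sStar R X [] = 1 := by
  simp [sStar, freeSStar]

theorem s_append (α β : List 𝒜) : s R X (α ++ β) = s R X α * s R X β := by
  simp [s, freeS]

theorem sStar_append (α β : List 𝒜) : sStar R X (α ++ β) = sStar R X β * sStar R X α := by
  simp [sStar, freeSStar]

theorem s_cons (a : 𝒜) (α : List 𝒜) : s R X (a :: α) = s R X [a] * s R X α :=
  s_append [a] α

theorem sStar_cons (a : 𝒜) (α : List 𝒜) : sStar R X (a :: α) = sStar R X α * sStar R X [a] :=
  sStar_append [a] α

theorem s_sStar_s (a : 𝒜) : s R X [a] * sStar R X [a] * s R X [a] = s R X [a] := by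
  have h : mk R X _ = mk R X _ := RingQuot.mkAlgHom_rel R (Rel.s_sStar_s a)
  simp only [map_mul] at h
  exact h

theorem sStar_s_sStar (a : 𝒜) : sStar R X [a] * s R X [a] * sStar R X [a] = sStar R X [a] := by
  have h : mk R X _ = mk R X _ := RingQuot.mkAlgHom_rel R (Rel.sStar_s_sStar a)
  simp only [map_mul] at h
  exact h

theorem cylinder (α β : language X) :
    s R X β * sStar R X α * s R X α * sStar R X β = p R X (relCylinderMem X α β) := by
  have h : mk R X _ = mk R X _ := RingQuot.mkAlgHom_rel R (Rel.cylinder α β)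
  simp only [map_mul] at h
  exact h

variable (hX : Admissible X)
include hX

theorem sStar_mul_s {α : List 𝒜} (h : α ∈ language X) :
    sStar R X α * s R X α = p R X (hX.preMem α ⊤) := by
  have := cylinder (R := R) ⟨α, h⟩ ⟨[], hX.nil_mem⟩
  rw [s_nil, sStar_nil, one_mul, mul_one] at this
  rw [this]
  exact congrArg _ (Subtype.ext (relCylinder_nil_right α))

theorem s_mul_sStar {α : List 𝒜} (h : α ∈ language X) :
    s R X α * sStar R X α = p R X (hX.imgMem α ⊤) := by
  have := cylinder (R := R) ⟨[], hX.nil_mem⟩ ⟨α, h⟩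
  rw [s_nil, sStar_nil, mul_one, mul_one] at this
  rw [this]
  exact congrArg _ (Subtype.ext (relCylinder_nil_left α))

theorem p_img_mul_s (a : 𝒜) : p R X (hX.imgMem [a] ⊤) * s R X [a] = s R X [a] := by
  rw [← s_mul_sStar hX (hX.letter_mem a), s_sStar_s]

theorem sStar_mul_p_img (a : 𝒜) : sStar R X [a] * p R X (hX.imgMem [a] ⊤) = sStar R X [a] := by
  rw [← s_mul_sStar hX (hX.letter_mem a), ← mul_assoc, sStar_s_sStar]

theorem img_inf_img {a b : 𝒜} (h : a ≠ b) : hX.imgMem [a] ⊤ ⊓ hX.imgMem [b] ⊤ = ⊥ := by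
  apply Subtype.ext
  ext z
  change z ∈ img [a] Set.univ ∧ z ∈ img [b] Set.univ ↔ False
  rw [iff_false, hX.mem_img_univ_iff, hX.mem_img_univ_iff]
  rintro ⟨h1, h2⟩
  have : [a] = [b] := h1.symm.trans h2
  exact h (by simpa using this)

theorem sStar_mul_s_of_ne {a b : 𝒜} (h : a ≠ b) : sStar R X [a] * s R X [b] = 0 := by
  rw [← sStar_mul_p_img hX, ← p_img_mul_s hX b, mul_assoc, ← mul_assoc (p R X _), ← p_inf,
    img_inf_img hX h, p_bot, zero_mul, mul_zero]

/-- The basic commutation rule, by induction on how A is built from the generators C(α, β), where it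
follows from the defining relations. -/
theorem p_mul_s_letter (A : boolAlg X) (a : 𝒜) :
    p R X A * s R X [a] = s R X [a] * p R X (hX.preMem [a] A) := by
  obtain ⟨A, hA⟩ := A
  -- Allows `pre [a] A` to be replaced by an equal set although membership proofs depend on it.
  have key (A : Set X) (hA : A ∈ boolAlg X) (A' : Set X) (hA' : A' ∈ boolAlg X)
      (h : pre [a] A = A') (h' : p R X ⟨A, hA⟩ * s R X [a] = s R X [a] * p R X ⟨A', hA'⟩) :
      p R X ⟨A, hA⟩ * s R X [a] = s R X [a] * p R X (hX.preMem [a] ⟨A, hA⟩) := by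
    subst h; exact h'
  induction hA using BooleanSubalgebra.closure_bot_sup_induction with
  | mem C hC =>
    obtain ⟨α, hα, β, hβ, rfl⟩ := hC
    change p R X (relCylinderMem X ⟨α, hα⟩ ⟨β, hβ⟩) * _ = _
    cases β with
    | nil =>
      by_cases h : α ++ [a] ∈ language X
      · refine key _ _ _ (hX.preMem (α ++ [a]) ⊤).2 (hX.pre_singleton_relCylinder a α) ?_
        change p R X (relCylinderMem X ⟨α, hα⟩ ⟨[], hβ⟩) * _ = _ * p R X (hX.preMem (α ++ [a]) ⊤)
        rw [← sStar_mul_s hX h, s_append, sStar_append, ← cylinder, s_nil, sStar_nil]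
        simp only [one_mul, mul_one, ← mul_assoc]
        rw [s_mul_sStar hX (hX.letter_mem a)]
        have h1 : sStar R X α * s R X α = p R X (hX.preMem α ⊤) := sStar_mul_s hX hα
        rw [mul_assoc (p R X _), h1, p_comm, mul_assoc, p_img_mul_s hX]
      -- The relations say nothing directly about the word αa outside the language, so both sides
      -- are shown to vanish from C(α, ω) ∩ img a = ∅.
      · have h1 : pre [a] (relCylinder X α []) = ∅ := by
          rw [hX.pre_singleton_relCylinder]
          ext x
          simp only [pre, Set.mem_ofPred_eq, Set.mem_univ, exists_prop, and_true,
            Set.mem_empty_iff_false, iff_false]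
          exact fun h' => h (mem_language_of_append_mem h')
        refine key _ _ ∅ BooleanSubalgebra.bot_mem h1 ?_
        have h2 : relCylinderMem X ⟨α, hα⟩ ⟨[], hβ⟩ ⊓ hX.imgMem [a] ⊤ = ⊥ := by
          apply Subtype.ext
          ext z
          change z ∈ relCylinder X α [] ∧ z ∈ img [a] Set.univ ↔ False
          rw [iff_false]
          rintro ⟨h3, x, -, h4⟩
          have h5 : z = ⟨[a] ++ₛ x, h4 ▸ z.2⟩ := Subtype.ext h4
          have : x ∈ pre [a] (relCylinder X α []) := ⟨h4 ▸ z.2, h5 ▸ h3⟩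
          rwa [h1] at this
        have h3 : p R X ⟨∅, BooleanSubalgebra.bot_mem⟩ = 0 := p_bot
        change p R X (relCylinderMem X ⟨α, hα⟩ ⟨[], hβ⟩) * _ = _
        rw [h3, mul_zero, ← p_img_mul_s hX, ← mul_assoc, ← p_inf, h2, p_bot, zero_mul]
    | cons b β =>
      have hβ' : β ∈ language X := hX.language_of_append (α := [b]) hβ
      by_cases h : b = a
      · subst h
        refine key _ _ _ (hX.preMem [b] ⊤ ⊓ relCylinderMem X ⟨α, hα⟩ ⟨β, hβ'⟩).2
          (pre_singleton_relCylinder_cons b α β) ?_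
        change p R X (relCylinderMem X ⟨α, hα⟩ ⟨b :: β, hβ⟩) * _ =
          _ * p R X (hX.preMem [b] ⊤ ⊓ relCylinderMem X ⟨α, hα⟩ ⟨β, hβ'⟩)
        rw [inf_comm, p_inf, ← cylinder, ← cylinder, ← sStar_mul_s hX (hX.letter_mem b)]
        simp only [s_cons b β, sStar_cons b β, mul_assoc]
      · refine key _ _ ∅ BooleanSubalgebra.bot_mem (pre_singleton_relCylinder_cons_of_ne h α β) ?_
        have h3 : p R X ⟨∅, BooleanSubalgebra.bot_mem⟩ = 0 := p_bot
        change p R X (relCylinderMem X ⟨α, hα⟩ ⟨b :: β, hβ⟩) * _ = _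
        rw [h3, mul_zero, ← cylinder, sStar_cons b β]
        simp only [mul_assoc]
        rw [sStar_mul_s_of_ne hX h]
        simp only [mul_zero]
  | bot =>
    refine key _ _ ∅ BooleanSubalgebra.bot_mem (pre_empty _) ?_
    have h3 : p R X ⟨∅, BooleanSubalgebra.bot_mem⟩ = 0 := p_bot
    rw [h3, mul_zero]
    exact (congrArg (· * _) h3).trans (zero_mul _)
  | sup A hA B hB ihA ihB =>
    change p R X (⟨A, hA⟩ ⊔ ⟨B, hB⟩) * _ = _
    have : hX.preMem [a] (⟨A, hA⟩ ⊔ ⟨B, hB⟩) = hX.preMem [a] ⟨A, hA⟩ ⊔ hX.preMem [a] ⟨B, hB⟩ :=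
      Subtype.ext (pre_union _ _ _)
    change _ = _ * p R X (hX.preMem [a] (⟨A, hA⟩ ⊔ ⟨B, hB⟩))
    rw [this, p_sup, p_sup, p_inf, p_inf, sub_mul, add_mul, mul_assoc, ihB, ← mul_assoc, ihA]
    simp only [mul_sub, mul_add, mul_assoc]
  | compl A hA ih =>
    change p R X (⟨A, hA⟩ᶜ) * _ = _ * p R X (hX.preMem [a] (⟨A, hA⟩ᶜ))
    have : hX.preMem [a] (⟨A, hA⟩ᶜ) = hX.preMem [a] ⊤ ⊓ (hX.preMem [a] ⟨A, hA⟩)ᶜ :=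
      Subtype.ext (pre_compl _ _)
    rw [this, p_inf, p_compl, p_compl, sub_mul, one_mul, ih, ← mul_assoc,
      ← sStar_mul_s hX (hX.letter_mem a), ← mul_assoc, s_sStar_s, mul_sub, mul_one]

theorem preMem_append (α β : List 𝒜) (A : boolAlg X) :
    hX.preMem (α ++ β) A = hX.preMem β (hX.preMem α A) :=
  Subtype.ext (hX.pre_append _ _ _)

theorem preMem_cons (a : 𝒜) (α : List 𝒜) (A : boolAlg X) :
    hX.preMem (a :: α) A = hX.preMem α (hX.preMem [a] A) :=
  preMem_append hX [a] α A

theorem preMem_nil (A : boolAlg X) : hX.preMem [] A = A :=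
  Subtype.ext (pre_nil _)

theorem p_mul_s (A : boolAlg X) (α : List 𝒜) :
    p R X A * s R X α = s R X α * p R X (hX.preMem α A) := by
  induction α generalizing A with
  | nil => rw [s_nil, mul_one, one_mul, preMem_nil]
  | cons a α ih => rw [s_cons a α, ← mul_assoc, p_mul_s_letter hX, mul_assoc, ih, preMem_cons hX a α, mul_assoc]

/-- Inserting s_a s_a^*, which commutes with p_A, reduces this to the rule for p_A s_a. -/
theorem sStar_mul_p_letter (A : boolAlg X) (a : 𝒜) :
    sStar R X [a] * p R X A = p R X (hX.preMem [a] A) * sStar R X [a] := by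
  have h1 : sStar R X [a] * s R X [a] = p R X (hX.preMem [a] ⊤) := sStar_mul_s hX (hX.letter_mem a)
  calc sStar R X [a] * p R X A
      = sStar R X [a] * (p R X A * s R X [a]) * sStar R X [a] := by
        rw [mul_assoc, mul_assoc (p R X A), s_mul_sStar hX (hX.letter_mem a), p_comm, ← mul_assoc,
          sStar_mul_p_img hX]
    _ = _ := by
        rw [p_mul_s_letter hX, ← mul_assoc, h1, p_comm, ← h1]
        simp only [mul_assoc]
        rw [← mul_assoc (sStar R X [a]), sStar_s_sStar]

theorem sStar_mul_p (A : boolAlg X) (α : List 𝒜) :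
    sStar R X α * p R X A = p R X (hX.preMem α A) * sStar R X α := by
  induction α generalizing A with
  | nil => rw [sStar_nil, mul_one, one_mul, preMem_nil]
  | cons a α ih =>
    rw [sStar_cons a α, mul_assoc, sStar_mul_p_letter hX, ← mul_assoc, ih, preMem_cons hX a α,
      mul_assoc]

theorem preMem_top_of_notMem {α : List 𝒜} (h : α ∉ language X) : hX.preMem α ⊤ = ⊥ := by
  apply Subtype.ext
  ext x
  change x ∈ pre α Set.univ ↔ False
  rw [iff_false]
  exact fun ⟨h', _⟩ => h (mem_language_of_append_mem h')

/-- Lets monomials range over arbitrary words in what follows. -/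
theorem s_eq_zero {α : List 𝒜} (h : α ∉ language X) : s R X α = 0 := by
  rw [← one_mul (s R X α), ← p_top, p_mul_s hX, preMem_top_of_notMem hX h, p_bot, mul_zero]

theorem sStar_eq_zero {α : List 𝒜} (h : α ∉ language X) : sStar R X α = 0 := by
  rw [← mul_one (sStar R X α), ← p_top, sStar_mul_p hX, preMem_top_of_notMem hX h, p_bot, zero_mul]

theorem monomial_mul_p (α β : List 𝒜) (A B : boolAlg X) :
    s R X α * p R X A * sStar R X β * p R X B =
      s R X α * p R X (A ⊓ hX.preMem β B) * sStar R X β := by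
  rw [mul_assoc, sStar_mul_p hX, p_inf]
  simp only [mul_assoc]

theorem monomial_nil_mul_s (α : List 𝒜) (A : boolAlg X) (a : 𝒜) :
    s R X α * p R X A * sStar R X [] * s R X [a] =
      s R X (α ++ [a]) * p R X (hX.preMem [a] A) * sStar R X [] := by
  rw [sStar_nil, mul_one, mul_one, mul_assoc, p_mul_s hX, s_append, mul_assoc]

theorem monomial_cons_mul_s (α β : List 𝒜) (A : boolAlg X) (a : 𝒜) :
    s R X α * p R X A * sStar R X (a :: β) * s R X [a] =
      s R X α * p R X (A ⊓ hX.preMem β (hX.preMem [a] ⊤)) * sStar R X β := by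
  rw [sStar_cons a β, mul_assoc, mul_assoc (sStar R X β), sStar_mul_s hX (hX.letter_mem a),
    ← mul_assoc, monomial_mul_p hX]

theorem monomial_cons_mul_s_of_ne (α β : List 𝒜) (A : boolAlg X) {a b : 𝒜} (h : b ≠ a) :
    s R X α * p R X A * sStar R X (b :: β) * s R X [a] = 0 := by
  rw [sStar_cons b β, mul_assoc, mul_assoc (sStar R X β), sStar_mul_s_of_ne hX h, mul_zero, mul_zero]

omit hX in
theorem monomial_mul_sStar (α β : List 𝒜) (A : boolAlg X) (a : 𝒜) :
    s R X α * p R X A * sStar R X β * sStar R X [a] =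
      s R X α * p R X A * sStar R X (a :: β) := by
  rw [sStar_cons a β, mul_assoc]

end Relations
end UnitalAlgebra
end Subshift

/-! ### The representation over Laurent polynomials -/

namespace Subshift

section Representation

variable {𝒜 : Type u} {R : Type v} [CommRing R] {X : Set (Stream' 𝒜)}

open Finsupp LaurentPolynomial

section Operators

variable (R X)

/-- The free module over the Laurent polynomials with basis `X`. -/
abbrev RepModule : Type (max u v) := X →₀ LaurentPolynomial R

variable {X} in
open Classical in
/-- The vector `m • e_z`, understood as `0` if `z` is not in `X`. -/
noncomputable def vec (z : Stream' 𝒜) (m : LaurentPolynomial R) : RepModule R X :=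
  if h : z ∈ X then single ⟨z, h⟩ m else 0

/-- The operator `e_x ↦ T e_{ax}`. -/
noncomputable def opS (a : 𝒜) : Module.End (LaurentPolynomial R) (RepModule R X) :=
  Finsupp.linearCombination _ fun x : X => vec R (Stream'.cons a x) (T 1)

open Classical in
/-- The operator `e_{ax} ↦ T⁻¹ e_x`. -/
noncomputable def opSStar (a : 𝒜) : Module.End (LaurentPolynomial R) (RepModule R X) :=
  Finsupp.linearCombination _ fun x : X =>
    if (x : Stream' 𝒜).head = a then vec R (x : Stream' 𝒜).tail (T (-1)) else 0

open Classical in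
/-- The projection onto the span of the `e_x` with `x ∈ A`. -/
noncomputable def opP (A : boolAlg X) : Module.End (LaurentPolynomial R) (RepModule R X) :=
  Finsupp.linearCombination _ fun x : X => if x ∈ (A : Set X) then single x 1 else 0

/-- The representation of the free algebra given by `opP`, `opS` and `opSStar`. -/
noncomputable def freeRep :
    FreeAlgebra R (Gen X) →ₐ[R] Module.End (LaurentPolynomial R) (RepModule R X) :=
  FreeAlgebra.lift R fun
    | Gen.p A => opP R X A
    | Gen.s a => opS R X a
    | Gen.sStar a => opSStar R X a

end Operators

theorem vec_of_mem {z : Stream' 𝒜} (h : z ∈ X) (m : LaurentPolynomial R) :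
    vec R z m = single (⟨z, h⟩ : X) m :=
  dif_pos h

theorem vec_of_notMem {z : Stream' 𝒜} (h : z ∉ X) (m : LaurentPolynomial R) :
    (vec R z m : RepModule R X) = 0 :=
  dif_neg h

theorem vec_coe (z : X) (m : LaurentPolynomial R) : vec R (z : Stream' 𝒜) m = single z m :=
  vec_of_mem z.2 m

theorem smul_vec (z : Stream' 𝒜) (l m : LaurentPolynomial R) :
    l • (vec R z m : RepModule R X) = vec R z (m * l) := by
  by_cases h : z ∈ X
  · rw [vec_of_mem h, vec_of_mem h, smul_single, smul_eq_mul, mul_comm]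
  · rw [vec_of_notMem h, vec_of_notMem h, smul_zero]

theorem opS_single (a : 𝒜) (x : X) (m : LaurentPolynomial R) :
    opS R X a (single x m) = vec R (Stream'.cons a x) (T 1 * m) := by
  rw [opS, linearCombination_single, smul_vec]

theorem opP_single_of_mem {A : boolAlg X} {x : X} (h : x ∈ (A : Set X))
    (m : LaurentPolynomial R) : opP R X A (single x m) = single x m := by
  simp [opP, linearCombination_single, h]

theorem opP_single_of_notMem {A : boolAlg X} {x : X} (h : x ∉ (A : Set X))
    (m : LaurentPolynomial R) : opP R X A (single x m) = 0 := by
  simp [opP, linearCombination_single, h]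

theorem freeRep_p (A : boolAlg X) : freeRep R X (freeP R X A) = opP R X A := by
  simp [freeRep, freeP]

theorem freeRep_s_nil : freeRep R X (freeS R X []) = 1 := by
  simp [freeS]

theorem freeRep_sStar_nil : freeRep R X (freeSStar R X []) = 1 := by
  simp [freeSStar]

theorem freeRep_s_cons (a : 𝒜) (α : List 𝒜) :
    freeRep R X (freeS R X (a :: α)) = opS R X a * freeRep R X (freeS R X α) := by
  simp [freeRep, freeS]

theorem freeRep_sStar_cons (a : 𝒜) (α : List 𝒜) :
    freeRep R X (freeSStar R X (a :: α)) = freeRep R X (freeSStar R X α) * opSStar R X a := by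
  simp [freeRep, freeSStar]

variable (hX : Admissible X)
include hX

theorem opS_vec (a : 𝒜) (z : Stream' 𝒜) (m : LaurentPolynomial R) :
    opS R X a (vec R z m) = vec R (Stream'.cons a z) (T 1 * m) := by
  by_cases h : z ∈ X
  · rw [vec_of_mem h, opS_single]
  -- The convention that `vec` is 0 outside X is consistent because az ∈ X forces z ∈ X.
  · rw [vec_of_notMem h, map_zero, vec_of_notMem fun h' => h (hX.mem_of_cons h')]

theorem freeRep_s_vec (α : List 𝒜) (z : Stream' 𝒜) (m : LaurentPolynomial R) :
    freeRep R X (freeS R X α) (vec R z m) = vec R (α ++ₛ z) (T α.length * m) := by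
  induction α with
  | nil => simp [freeRep_s_nil]
  | cons a α ih =>
    rw [freeRep_s_cons, Module.End.mul_apply, ih, opS_vec hX, ← mul_assoc, ← T_add,
      Stream'.cons_append_stream, List.length_cons, Nat.cast_succ, add_comm]

theorem freeRep_s_single (α : List 𝒜) (x : X) (m : LaurentPolynomial R) :
    freeRep R X (freeS R X α) (single x m) = vec R (α ++ₛ x) (T α.length * m) := by
  rw [← vec_coe, freeRep_s_vec hX]

omit hX in
theorem opSStar_single_of_eq {a : 𝒜} {x z : X} (h : (z : Stream' 𝒜) = Stream'.cons a x)
    (m : LaurentPolynomial R) : opSStar R X a (single z m) = single x (T (-1) * m) := by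
  rw [opSStar, linearCombination_single, h, Stream'.head_cons, if_pos rfl, Stream'.tail_cons,
    vec_coe, smul_single, smul_eq_mul, mul_comm]

omit hX in
theorem opSStar_single_of_ne {a : 𝒜} {z : X} (h : (z : Stream' 𝒜).head ≠ a)
    (m : LaurentPolynomial R) : opSStar R X a (single z m) = 0 := by
  rw [opSStar, linearCombination_single, if_neg h, smul_zero]

theorem freeRep_sStar_single {α : List 𝒜} {x z : X} (h : (z : Stream' 𝒜) = α ++ₛ x)
    (m : LaurentPolynomial R) :
    freeRep R X (freeSStar R X α) (single z m) = single x (T (-(α.length : ℤ)) * m) := by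
  induction α generalizing z m with
  | nil =>
    obtain rfl : z = x := Subtype.ext h
    simp [freeRep_sStar_nil]
  | cons a α ih =>
    have h1 : α ++ₛ (x : Stream' 𝒜) ∈ X := hX.mem_of_cons (a := a) (by
      rw [← Stream'.cons_append_stream, ← h]; exact z.2)
    rw [freeRep_sStar_cons, Module.End.mul_apply,
      opSStar_single_of_eq (x := ⟨_, h1⟩) h, ih rfl, ← mul_assoc, ← T_add, List.length_cons,
      Nat.cast_succ, neg_add]

theorem freeRep_sStar_single_of_notMem {α : List 𝒜} {z : X} (h : z ∉ img α Set.univ)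
    (m : LaurentPolynomial R) : freeRep R X (freeSStar R X α) (single z m) = 0 := by
  induction α generalizing z m with
  | nil => exact absurd ((img_nil (Set.univ : Set X)).symm ▸ Set.mem_univ z) h
  | cons a α ih =>
    rw [freeRep_sStar_cons, Module.End.mul_apply]
    by_cases h1 : (z : Stream' 𝒜).head = a
    · have h2 : (z : Stream' 𝒜) = Stream'.cons a (z : Stream' 𝒜).tail := by
        rw [← h1, Stream'.eta]
      rw [opSStar_single_of_eq (x := ⟨_, hX.tail_mem _ z.2⟩) h2, ih]
      rintro ⟨x, -, h3⟩
      refine h ⟨x, trivial, ?_⟩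
      rw [h2, Stream'.cons_append_stream]
      exact congrArg _ h3
    · rw [opSStar_single_of_ne h1, map_zero]

theorem freeRep_rel {a b : FreeAlgebra R (Gen X)} (h : Rel R X a b) :
    freeRep R X a = freeRep R X b := by
  refine Finsupp.lhom_ext fun z m => ?_
  cases h with
  | p_top =>
    rw [freeRep_p, map_one, opP_single_of_mem (Set.mem_univ z), Module.End.one_apply]
  | p_bot =>
    rw [freeRep_p, map_zero, opP_single_of_notMem (Set.notMem_empty z), LinearMap.zero_apply]
  | p_inf A B =>
    rw [map_mul, Module.End.mul_apply]
    simp only [freeRep_p]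
    by_cases hB : z ∈ (B : Set X)
    · rw [opP_single_of_mem hB]
      by_cases hA : z ∈ (A : Set X)
      · rw [opP_single_of_mem hA, opP_single_of_mem (A := A ⊓ B) ⟨hA, hB⟩]
      · rw [opP_single_of_notMem hA, opP_single_of_notMem (A := A ⊓ B) fun h => hA h.1]
    · rw [opP_single_of_notMem hB, opP_single_of_notMem (A := A ⊓ B) fun h => hB h.2, map_zero]
  | p_sup A B =>
    rw [map_sub, map_add, LinearMap.sub_apply, LinearMap.add_apply]
    simp only [freeRep_p]
    by_cases hB : z ∈ (B : Set X) <;> by_cases hA : z ∈ (A : Set X)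
    · rw [opP_single_of_mem hB, opP_single_of_mem hA,
        opP_single_of_mem (A := A ⊓ B) ⟨hA, hB⟩, opP_single_of_mem (A := A ⊔ B) (Or.inl hA),
        add_sub_cancel_right]
    · rw [opP_single_of_mem hB, opP_single_of_notMem hA,
        opP_single_of_notMem (A := A ⊓ B) fun h => hA h.1,
        opP_single_of_mem (A := A ⊔ B) (Or.inr hB), zero_add, sub_zero]
    · rw [opP_single_of_mem hA, opP_single_of_notMem hB,
        opP_single_of_notMem (A := A ⊓ B) fun h => hB h.2,
        opP_single_of_mem (A := A ⊔ B) (Or.inl hA), add_zero, sub_zero]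
    · rw [opP_single_of_notMem hA, opP_single_of_notMem hB,
        opP_single_of_notMem (A := A ⊓ B) fun h => hB h.2,
        opP_single_of_notMem (A := A ⊔ B) (not_or.2 ⟨hA, hB⟩), add_zero, sub_zero]
  | s_sStar_s a =>
    simp only [map_mul, Module.End.mul_apply]
    rw [freeRep_s_single hX]
    by_cases h : [a] ++ₛ (z : Stream' 𝒜) ∈ X
    · rw [vec_of_mem h, freeRep_sStar_single hX (x := z) rfl, freeRep_s_single hX, vec_of_mem h]
      simp [← mul_assoc]
    · simp only [vec_of_notMem h, map_zero]
  | sStar_s_sStar a =>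
    simp only [map_mul, Module.End.mul_apply]
    by_cases h : z ∈ img [a] Set.univ
    · obtain ⟨x, -, h⟩ := h
      rw [freeRep_sStar_single hX h, freeRep_s_single hX, ← h, vec_coe,
        freeRep_sStar_single hX h]
      simp [← mul_assoc]
    · rw [freeRep_sStar_single_of_notMem hX h, map_zero, map_zero]
  | cylinder α β =>
    simp only [map_mul, Module.End.mul_apply, freeRep_p]
    by_cases h : z ∈ img (β : List 𝒜) Set.univ
    · obtain ⟨x, -, h⟩ := h
      rw [freeRep_sStar_single hX h, freeRep_s_single hX]
      by_cases h' : (α : List 𝒜) ++ₛ (x : Stream' 𝒜) ∈ X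
      · rw [vec_of_mem h', freeRep_sStar_single hX rfl, freeRep_s_single hX, ← h, vec_coe,
          opP_single_of_mem (A := relCylinderMem X α β) ⟨x, h, h'⟩]
        simp [← mul_assoc]
      · rw [vec_of_notMem h', map_zero, map_zero, opP_single_of_notMem]
        rintro ⟨y, hy, hy'⟩
        rw [h] at hy
        exact h' (Stream'.append_right_injective _ _ _ hy ▸ hy')
    · rw [freeRep_sStar_single_of_notMem hX h, map_zero, map_zero, map_zero, opP_single_of_notMem]
      rintro ⟨y, hy, -⟩
      exact h ⟨⟨y, hX.mem_of_append (hy ▸ z.2)⟩, trivial, hy⟩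

omit hX in
variable (R) in
/-- The representation of the unital subshift algebra on the free module with basis `X` over the
Laurent polynomials. -/
noncomputable def Admissible.rep (hX : Admissible X) :
    UnitalAlgebra R X →ₐ[R] Module.End (LaurentPolynomial R) (RepModule R X) :=
  RingQuot.liftAlgHom R ⟨freeRep R X, fun _ _ h => freeRep_rel hX h⟩

theorem rep_mk (a : FreeAlgebra R (Gen X)) :
    hX.rep R (UnitalAlgebra.mk R X a) = freeRep R X a :=
  RingQuot.liftAlgHom_mkAlgHom_apply _ _ _ _

theorem rep_p_single_of_mem {A : boolAlg X} {x : X} (h : x ∈ (A : Set X))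
    (m : LaurentPolynomial R) : hX.rep R (UnitalAlgebra.p R X A) (single x m) = single x m := by
  rw [UnitalAlgebra.p, rep_mk, freeRep_p, opP_single_of_mem h]

theorem rep_p_single_of_notMem {A : boolAlg X} {x : X} (h : x ∉ (A : Set X))
    (m : LaurentPolynomial R) : hX.rep R (UnitalAlgebra.p R X A) (single x m) = 0 := by
  rw [UnitalAlgebra.p, rep_mk, freeRep_p, opP_single_of_notMem h]

theorem rep_s_single (α : List 𝒜) (x : X) (m : LaurentPolynomial R) :
    hX.rep R (UnitalAlgebra.s R X α) (single x m) = vec R (α ++ₛ x) (T α.length * m) := by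
  rw [UnitalAlgebra.s, rep_mk, freeRep_s_single hX]

theorem rep_sStar_single {α : List 𝒜} {x z : X} (h : (z : Stream' 𝒜) = α ++ₛ x)
    (m : LaurentPolynomial R) :
    hX.rep R (UnitalAlgebra.sStar R X α) (single z m) = single x (T (-(α.length : ℤ)) * m) := by
  rw [UnitalAlgebra.sStar, rep_mk, freeRep_sStar_single hX h]

theorem rep_sStar_single_of_notMem {α : List 𝒜} {z : X} (h : z ∉ img α Set.univ)
    (m : LaurentPolynomial R) : hX.rep R (UnitalAlgebra.sStar R X α) (single z m) = 0 := by
  rw [UnitalAlgebra.sStar, rep_mk, freeRep_sStar_single_of_notMem hX h]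

theorem rep_monomial_single (α : List 𝒜) {β : List 𝒜} {A : boolAlg X} {x z : X}
    (hx : x ∈ (A : Set X)) (hz : (z : Stream' 𝒜) = β ++ₛ x) (m : LaurentPolynomial R) :
    hX.rep R (UnitalAlgebra.s R X α * UnitalAlgebra.p R X A * UnitalAlgebra.sStar R X β)
      (single z m) = vec R (α ++ₛ x) (T ((α.length : ℤ) - β.length) * m) := by
  rw [map_mul, map_mul, Module.End.mul_apply, Module.End.mul_apply, rep_sStar_single hX hz,
    rep_p_single_of_mem hX hx, rep_s_single hX, ← mul_assoc, ← T_add, sub_eq_add_neg]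

theorem rep_monomial_single_of_notMem (α : List 𝒜) {β : List 𝒜} {A : boolAlg X} {z : X}
    (hz : z ∉ img β (A : Set X)) (m : LaurentPolynomial R) :
    hX.rep R (UnitalAlgebra.s R X α * UnitalAlgebra.p R X A * UnitalAlgebra.sStar R X β)
      (single z m) = 0 := by
  rw [map_mul, map_mul, Module.End.mul_apply, Module.End.mul_apply]
  by_cases h : z ∈ img β Set.univ
  · obtain ⟨x, -, h⟩ := h
    rw [rep_sStar_single hX h, rep_p_single_of_notMem hX fun h' => hz ⟨x, h', h⟩, map_zero]
  · rw [rep_sStar_single_of_notMem hX h, map_zero, map_zero]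

end Representation
end Subshift

/-! ### Spans of monomials and the degree filtration -/

theorem Submodule.mul_mem_of_mem_span {R B : Type*} [CommRing R] [Ring B] [Algebra R B]
    {S : Set B} {T : Submodule R B} {y : B} (h : ∀ x ∈ S, x * y ∈ T) {x : B}
    (hx : x ∈ Submodule.span R S) : x * y ∈ T :=
  (Submodule.span_le.2 h : Submodule.span R S ≤ T.comap (LinearMap.mulRight R y)) hx

theorem Submodule.mul_mem_of_mem_span' {R B : Type*} [CommRing R] [Ring B] [Algebra R B]
    {S : Set B} {T : Submodule R B} {y : B} (h : ∀ x ∈ S, y * x ∈ T) {x : B}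
    (hx : x ∈ Submodule.span R S) : y * x ∈ T :=
  (Submodule.span_le.2 h : Submodule.span R S ≤ T.comap (LinearMap.mulLeft R y)) hx

namespace Subshift

namespace UnitalAlgebra

section Spans

variable {𝒜 : Type u} {R : Type v} [CommRing R] {X : Set (Stream' 𝒜)}

variable (R X) in
/-- The span of the monomials `s_α p_A s_β^*` with `|α| - |β| = n` and `|β| ≤ N`. -/
def boundedPart (n : ℤ) (N : ℕ) : Submodule R (UnitalAlgebra R X) :=
  Submodule.span R
    {x | ∃ (α β : List 𝒜) (A : boolAlg X),
      (α.length : ℤ) - (β.length : ℤ) = n ∧ β.length ≤ N ∧ x = s R X α * p R X A * sStar R X β}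

theorem monomial_mem_boundedPart {α β : List 𝒜} {A : boolAlg X} {n : ℤ} {N : ℕ}
    (h : (α.length : ℤ) - (β.length : ℤ) = n) (hN : β.length ≤ N) :
    s R X α * p R X A * sStar R X β ∈ boundedPart R X n N :=
  Submodule.subset_span ⟨α, β, A, h, hN, rfl⟩

theorem boundedPart_mono (n : ℤ) {N N' : ℕ} (h : N ≤ N') :
    boundedPart R X n N ≤ boundedPart R X n N' :=
  Submodule.span_mono fun _ ⟨α, β, A, h1, h2, h3⟩ => ⟨α, β, A, h1, h2.trans h, h3⟩

variable (hX : Admissible X)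
include hX

theorem mul_p_mem_boundedPart {n : ℤ} {N : ℕ} {x : UnitalAlgebra R X}
    (hx : x ∈ boundedPart R X n N) (A : boolAlg X) : x * p R X A ∈ boundedPart R X n N := by
  refine Submodule.mul_mem_of_mem_span ?_ hx
  rintro _ ⟨α, β, B, h1, h2, rfl⟩
  rw [monomial_mul_p hX]
  exact monomial_mem_boundedPart h1 h2

/-- Right multiplication by s_a cancels the first letter of β or kills the monomial, and lengthens α
when β is empty. Either way the bound on |β| drops, which drives the induction for faithfulness. -/
theorem mul_s_mem_boundedPart {n : ℤ} {N : ℕ} {x : UnitalAlgebra R X}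
    (hx : x ∈ boundedPart R X n (N + 1)) (a : 𝒜) :
    x * s R X [a] ∈ boundedPart R X (n + 1) N := by
  refine Submodule.mul_mem_of_mem_span ?_ hx
  rintro _ ⟨α, β, B, h1, h2, rfl⟩
  cases β with
  | nil =>
    rw [monomial_nil_mul_s hX]
    refine monomial_mem_boundedPart ?_ (Nat.zero_le _)
    simp only [List.length_append, List.length_singleton, List.length_nil] at h1 ⊢
    push_cast at h1 ⊢
    lia
  | cons b β =>
    simp only [List.length_cons] at h1 h2
    push_cast at h1
    by_cases h : b = a
    · subst h
      rw [monomial_cons_mul_s hX]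
      exact monomial_mem_boundedPart (by lia) (by lia)
    · rw [monomial_cons_mul_s_of_ne hX α β B h]
      exact zero_mem _

omit hX in
theorem mul_sStar_mem_boundedPart {n : ℤ} {N : ℕ} {x : UnitalAlgebra R X}
    (hx : x ∈ boundedPart R X n N) (a : 𝒜) :
    x * sStar R X [a] ∈ boundedPart R X (n - 1) (N + 1) := by
  refine Submodule.mul_mem_of_mem_span ?_ hx
  rintro _ ⟨α, β, B, h1, h2, rfl⟩
  rw [monomial_mul_sStar]
  refine monomial_mem_boundedPart ?_ ?_
  · simp only [List.length_cons]
    push_cast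
    lia
  · simp only [List.length_cons]
    lia

theorem mem_degreePart_iff {n : ℤ} {x : UnitalAlgebra R X} :
    x ∈ degreePart R X n ↔ ∃ N, x ∈ boundedPart R X n N := by
  constructor
  · intro hx
    induction hx using Submodule.span_induction with
    | mem x hx =>
      obtain ⟨α, -, β, -, A, h, rfl⟩ := hx
      exact ⟨_, monomial_mem_boundedPart h le_rfl⟩
    | zero => exact ⟨0, zero_mem _⟩
    | add x y _ _ hx hy =>
      obtain ⟨N, hx⟩ := hx
      obtain ⟨N', hy⟩ := hy
      exact ⟨max N N', add_mem (boundedPart_mono n (le_max_left _ _) hx)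
        (boundedPart_mono n (le_max_right _ _) hy)⟩
    | smul r x _ hx =>
      obtain ⟨N, hx⟩ := hx
      exact ⟨N, Submodule.smul_mem _ _ hx⟩
  · rintro ⟨N, hx⟩
    refine (Submodule.span_le.2 ?_ : boundedPart R X n N ≤ degreePart R X n) hx
    rintro _ ⟨α, β, A, h, -, rfl⟩
    by_cases hα : α ∈ language X
    · by_cases hβ : β ∈ language X
      · exact Submodule.subset_span ⟨α, hα, β, hβ, A, h, rfl⟩
      · rw [sStar_eq_zero hX hβ, mul_zero]
        exact zero_mem _
    · rw [s_eq_zero hX hα, zero_mul, zero_mul]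
      exact zero_mem _

theorem monomial_mem_degreePart {α β : List 𝒜} {A : boolAlg X} {n : ℤ}
    (h : (α.length : ℤ) - (β.length : ℤ) = n) :
    s R X α * p R X A * sStar R X β ∈ degreePart R X n :=
  (mem_degreePart_iff hX).2 ⟨_, monomial_mem_boundedPart h le_rfl⟩

theorem mul_p_mem_degreePart {n : ℤ} {x : UnitalAlgebra R X} (hx : x ∈ degreePart R X n)
    (A : boolAlg X) : x * p R X A ∈ degreePart R X n := by
  obtain ⟨N, hx⟩ := (mem_degreePart_iff hX).1 hx
  exact (mem_degreePart_iff hX).2 ⟨N, mul_p_mem_boundedPart hX hx A⟩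

theorem mul_s_mem_degreePart {n : ℤ} {x : UnitalAlgebra R X} (hx : x ∈ degreePart R X n)
    (α : List 𝒜) : x * s R X α ∈ degreePart R X (n + α.length) := by
  induction α generalizing n x with
  | nil => simpa [s_nil] using hx
  | cons a α ih =>
    obtain ⟨N, hx⟩ := (mem_degreePart_iff hX).1 hx
    have := ih ((mem_degreePart_iff hX).2
      ⟨N, mul_s_mem_boundedPart hX (boundedPart_mono n N.le_succ hx) a⟩)
    rw [s_cons a α, ← mul_assoc, List.length_cons]
    convert! this using 2
    push_cast
    ring

theorem mul_sStar_mem_degreePart {n : ℤ} {x : UnitalAlgebra R X} (hx : x ∈ degreePart R X n)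
    (α : List 𝒜) : x * sStar R X α ∈ degreePart R X (n - α.length) := by
  induction α with
  | nil => simpa [sStar_nil] using hx
  | cons a α ih =>
    obtain ⟨N, h⟩ := (mem_degreePart_iff hX).1 ih
    rw [sStar_cons a α, ← mul_assoc, List.length_cons]
    convert! (mem_degreePart_iff hX).2 ⟨_, mul_sStar_mem_boundedPart h a⟩ using 2
    push_cast
    ring

theorem one_mem_degreePart : (1 : UnitalAlgebra R X) ∈ degreePart R X 0 := by
  have := monomial_mem_degreePart (R := R) hX (α := []) (β := []) (A := ⊤) (n := 0) (by simp)
  rwa [s_nil, sStar_nil, p_top, one_mul, mul_one] at this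

theorem mul_mem_degreePart {m n : ℤ} {x y : UnitalAlgebra R X} (hx : x ∈ degreePart R X m)
    (hy : y ∈ degreePart R X n) : x * y ∈ degreePart R X (m + n) := by
  refine Submodule.mul_mem_of_mem_span' ?_ hy
  rintro _ ⟨α, -, β, -, A, rfl, rfl⟩
  rw [← mul_assoc, ← mul_assoc, ← add_sub_assoc]
  exact mul_sStar_mem_degreePart hX (mul_p_mem_degreePart hX (mul_s_mem_degreePart hX hx α) A) β

theorem gradedMonoid_degreePart : SetLike.GradedMonoid (degreePart R X) where
  one_mem := one_mem_degreePart hX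
  mul_mem _ _ _ _ := mul_mem_degreePart hX

variable (R X) in
omit hX in
/-- The monomials `s_α p_A s_β^*`. -/
def monomials : Set (UnitalAlgebra R X) :=
  {x | ∃ (α β : List 𝒜) (A : boolAlg X), x = s R X α * p R X A * sStar R X β}

theorem mem_span_monomials (x : UnitalAlgebra R X) : x ∈ Submodule.span R (monomials R X) := by
  have h1 : (1 : UnitalAlgebra R X) ∈ Submodule.span R (monomials R X) :=
    Submodule.subset_span ⟨[], [], ⊤, by rw [s_nil, sStar_nil, p_top, one_mul, mul_one]⟩
  -- It suffices that the span is stable under right multiplication, which can be tested on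
  -- generators.
  suffices h : ∀ (a : FreeAlgebra R (Gen X)), ∀ y ∈ Submodule.span R (monomials R X),
      y * mk R X a ∈ Submodule.span R (monomials R X) by
    obtain ⟨a, rfl⟩ := RingQuot.mkAlgHom_surjective R (Rel R X) x
    have := h a 1 h1
    rwa [one_mul] at this
  intro a
  induction a using FreeAlgebra.induction with
  | grade0 r =>
    intro y hy
    rw [AlgHom.commutes, ← Algebra.commutes, ← Algebra.smul_def]
    exact Submodule.smul_mem _ _ hy
  | grade1 g =>
    intro y hy
    refine Submodule.mul_mem_of_mem_span ?_ hy
    rintro _ ⟨α, β, B, rfl⟩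
    cases g with
    | p A =>
      exact Submodule.subset_span ⟨_, _, _, monomial_mul_p hX α β B A⟩
    | s a =>
      have hs : mk R X (FreeAlgebra.ι R (Gen.s a)) = s R X [a] := by simp [s, freeS]
      rw [hs]
      cases β with
      | nil => exact Submodule.subset_span ⟨_, _, _, monomial_nil_mul_s hX α B a⟩
      | cons b β =>
        by_cases h : b = a
        · subst h
          exact Submodule.subset_span ⟨_, _, _, monomial_cons_mul_s hX α β B b⟩
        · rw [monomial_cons_mul_s_of_ne hX α β B h]
          exact zero_mem _
    | sStar a =>
      have hs : mk R X (FreeAlgebra.ι R (Gen.sStar a)) = sStar R X [a] := by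
        simp [sStar, freeSStar]
      rw [hs]
      exact Submodule.subset_span ⟨_, _, _, monomial_mul_sStar α β B a⟩
  | mul a b iha ihb =>
    intro y hy
    rw [map_mul, ← mul_assoc]
    exact ihb _ (iha _ hy)
  | add a b iha ihb =>
    intro y hy
    rw [map_add, mul_add]
    exact add_mem (iha _ hy) (ihb _ hy)

end Spans

/-! ### Faithfulness of the representation and the grading -/

section Faithful

open Finsupp LaurentPolynomial

variable {𝒜 : Type u} {R : Type v} [CommRing R] {X : Set (Stream' 𝒜)} (hX : Admissible X)
include hX

/-- A combination of projections is determined by its values as a function on X. Each new term c p_A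
is handled by cutting B along A, which is why B and d vary in the induction. -/
theorem linearCombination_p_mul_p {f : boolAlg X →₀ R} (B : boolAlg X) (d : R)
    (h : ∀ z ∈ (B : Set X),
      hX.rep R (linearCombination R (p R X) f) (single z 1) = single z (C d)) :
    linearCombination R (p R X) f * p R X B = d • p R X B := by
  induction f using Finsupp.induction generalizing B d with
  | zero =>
    by_cases hB : B = ⊥
    · rw [hB, p_bot, mul_zero, smul_zero]
    · have : ∃ z, z ∈ (B : Set X) := by
        by_contra! h'
        exact hB (Subtype.ext (Set.eq_empty_of_forall_notMem h'))
      obtain ⟨z, hz⟩ := this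
      have h1 := h z hz
      rw [map_zero, map_zero, LinearMap.zero_apply, eq_comm, single_eq_zero] at h1
      have hd : d = 0 := by simpa using congrArg (fun q : LaurentPolynomial R => q.coeff 0) h1
      rw [hd, map_zero, zero_mul, zero_smul]
  | single_add A c f _ _ ih =>
    simp only [map_add, linearCombination_single, LinearMap.add_apply, map_smul,
      LinearMap.smul_apply] at h ⊢
    have hs (z : X) : c • (single z 1 : RepModule R X) = single z (C c) := by
      rw [smul_single, smul_eq_C_mul, mul_one]
    -- On B ∩ A the term c p_A already contributes c, so the rest acts as d - c; off A it
    -- contributes nothing.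
    have h1 := ih (B ⊓ A) (d - c) (by
      intro z hz
      have := h z hz.1
      rw [rep_p_single_of_mem hX hz.2, hs] at this
      rw [map_sub, single_sub, ← this, add_sub_cancel_left])
    have h2 := ih (B ⊓ Aᶜ) d (by
      intro z hz
      have := h z hz.1
      rwa [rep_p_single_of_notMem hX hz.2, smul_zero, zero_add] at this)
    have hB : p R X B = p R X (B ⊓ A) + p R X (B ⊓ Aᶜ) := by
      rw [p_inf, p_inf, p_compl, mul_sub, mul_one, add_sub_cancel]
    have h3 : p R X A * p R X B = p R X (B ⊓ A) := by rw [p_comm, p_inf]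
    rw [add_mul, smul_mul_assoc, h3, hB, mul_add, h1, h2, sub_smul, smul_add]
    abel

theorem eq_zero_of_mem_boundedPart_zero_zero {x : UnitalAlgebra R X}
    (hx : x ∈ boundedPart R X 0 0) (h : hX.rep R x = 0) : x = 0 := by
  have hx' : x ∈ Submodule.span R (Set.range (p R X)) := by
    refine (Submodule.span_mono ?_ : boundedPart R X 0 0 ≤ _) hx
    rintro _ ⟨α, β, A, h1, h2, rfl⟩
    obtain rfl : β = [] := List.eq_nil_of_length_eq_zero (by lia)
    obtain rfl : α = [] := List.eq_nil_of_length_eq_zero (by simp at h1; simpa using h1)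
    exact ⟨A, by rw [s_nil, sStar_nil, one_mul, mul_one]⟩
  obtain ⟨f, rfl⟩ := (Finsupp.mem_span_range_iff_exists_finsupp).1 hx'
  have := linearCombination_p_mul_p hX (f := f) ⊤ 0 fun z _ => by
    rw [map_zero, single_zero]
    exact congrArg (· (single z 1)) h
  rwa [p_top, mul_one, zero_smul] at this

theorem sStar_mul_mem_boundedPart {n : ℕ} {x : UnitalAlgebra R X}
    (hx : x ∈ boundedPart R X (n + 1 : ℕ) 0) (a : 𝒜) :
    sStar R X [a] * x ∈ boundedPart R X n 0 := by
  refine Submodule.mul_mem_of_mem_span' ?_ hx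
  rintro _ ⟨α, β, A, h1, h2, rfl⟩
  cases α with
  | nil => simp at h1; lia
  | cons b α =>
    rw [s_cons b α, ← mul_assoc, ← mul_assoc, ← mul_assoc]
    by_cases h : a = b
    · subst h
      rw [sStar_mul_s hX (hX.letter_mem a), p_mul_s hX, mul_assoc (s R X α), ← p_inf]
      refine monomial_mem_boundedPart ?_ h2
      simp only [List.length_cons] at h1
      push_cast at h1
      lia
    · rw [sStar_mul_s_of_ne hX h, zero_mul, zero_mul, zero_mul]
      exact zero_mem _

/-- The alphabet may be infinite, so 1 need not be the sum of the s_a s_a^*. Only finitely many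
first letters of words α occur in x, and D is the union of their cylinders. -/
theorem exists_p_mul_eq {n : ℕ} {x : UnitalAlgebra R X}
    (hx : x ∈ boundedPart R X (n + 1 : ℕ) 0) :
    ∃ D, p R X D * x = x ∧ ∀ y, (∀ a, sStar R X [a] * y = 0) → p R X D * y = 0 := by
  induction hx using Submodule.span_induction with
  | mem x hx =>
    obtain ⟨α, β, A, h1, h2, rfl⟩ := hx
    cases α with
    | nil => simp at h1; lia
    | cons b α =>
      refine ⟨hX.imgMem [b] ⊤, ?_, fun y hy => ?_⟩
      · rw [s_cons b α, ← mul_assoc, ← mul_assoc, ← mul_assoc, p_img_mul_s hX]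
      · rw [← s_mul_sStar hX (hX.letter_mem b), mul_assoc, hy, mul_zero]
  | zero => exact ⟨⊥, mul_zero _, fun y _ => by rw [p_bot, zero_mul]⟩
  | add x y _ _ hx hy =>
    obtain ⟨D, h1, h2⟩ := hx
    obtain ⟨D', h1', h2'⟩ := hy
    refine ⟨D ⊔ D', ?_, fun z hz => ?_⟩
    · have e1 : p R X (D ⊔ D') * p R X D = p R X D := by
        rw [p_comm, p_mul_of_le le_sup_left]
      have e2 : p R X (D ⊔ D') * p R X D' = p R X D' := by
        rw [p_comm, p_mul_of_le le_sup_right]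
      rw [mul_add]
      congr 1
      · rw [← h1, ← mul_assoc, e1]
      · rw [← h1', ← mul_assoc, e2]
    · rw [p_sup, p_inf, sub_mul, add_mul, mul_assoc, h2 z hz, h2' z hz, mul_zero, add_zero,
        sub_zero]
  | smul r x _ hx =>
    obtain ⟨D, h1, h2⟩ := hx
    exact ⟨D, by rw [mul_smul_comm, h1], h2⟩

theorem eq_zero_of_mem_boundedPart_natCast_zero {n : ℕ} {x : UnitalAlgebra R X}
    (hx : x ∈ boundedPart R X n 0) (h : hX.rep R x = 0) : x = 0 := by
  induction n generalizing x with
  | zero => exact eq_zero_of_mem_boundedPart_zero_zero hX hx h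
  | succ n ih =>
    obtain ⟨D, h1, h2⟩ := exists_p_mul_eq hX hx
    rw [← h1]
    refine h2 x fun a => ih (sStar_mul_mem_boundedPart hX hx a) ?_
    rw [map_mul, h, mul_zero]

/-- D is the complement of the cylinders of the finitely many first letters of words β occurring in
x: p_D removes the terms with β nonempty, and fixes every y with y s_a = 0 for all a. -/
theorem exists_mul_p_mem_boundedPart {n : ℤ} {N : ℕ} {x : UnitalAlgebra R X}
    (hx : x ∈ boundedPart R X n N) :
    ∃ D, x * p R X D ∈ boundedPart R X n 0 ∧ ∀ y, (∀ a, y * s R X [a] = 0) → y * p R X D = y := by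
  induction hx using Submodule.span_induction with
  | mem x hx =>
    obtain ⟨α, β, A, h1, h2, rfl⟩ := hx
    cases β with
    | nil =>
      refine ⟨⊤, ?_, fun y _ => by rw [p_top, mul_one]⟩
      rw [p_top, mul_one]
      exact monomial_mem_boundedPart h1 le_rfl
    | cons b β =>
      refine ⟨(hX.imgMem [b] ⊤)ᶜ, ?_, fun y hy => ?_⟩
      · rw [p_compl, mul_sub, mul_one, sStar_cons b β, ← mul_assoc, mul_assoc _ (sStar R X [b]),
          sStar_mul_p_img hX, sub_self]
        exact zero_mem _
      · rw [p_compl, mul_sub, mul_one, ← s_mul_sStar hX (hX.letter_mem b), ← mul_assoc, hy,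
          zero_mul, sub_zero]
  | zero => exact ⟨⊤, by rw [zero_mul]; exact zero_mem _, fun y _ => by rw [p_top, mul_one]⟩
  | add x y _ _ hx hy =>
    obtain ⟨D, h1, h2⟩ := hx
    obtain ⟨D', h1', h2'⟩ := hy
    refine ⟨D ⊓ D', ?_, fun z hz => ?_⟩
    · rw [add_mul]
      refine add_mem ?_ ?_
      · rw [p_inf, ← mul_assoc]
        exact mul_p_mem_boundedPart hX h1 _
      · rw [inf_comm, p_inf, ← mul_assoc]
        exact mul_p_mem_boundedPart hX h1' _
    · rw [p_inf, ← mul_assoc, h2 z hz, h2' z hz]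
  | smul r x _ hx =>
    obtain ⟨D, h1, h2⟩ := hx
    exact ⟨D, by rw [smul_mul_assoc]; exact Submodule.smul_mem _ _ h1, h2⟩

theorem eq_zero_of_mem_boundedPart_zero {n : ℤ} {x : UnitalAlgebra R X}
    (hx : x ∈ boundedPart R X n 0) (h : hX.rep R x = 0) : x = 0 := by
  obtain ⟨n, rfl⟩ | hn : (∃ k : ℕ, n = k) ∨ n < 0 := by
    rcases lt_or_ge n 0 with hn | hn
    · exact Or.inr hn
    · exact Or.inl ⟨n.toNat, by lia⟩
  · exact eq_zero_of_mem_boundedPart_natCast_zero hX hx h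
  -- With β empty the degree is |α|, so there are no monomials of negative degree.
  · refine (Submodule.span_le.2 ?_ : boundedPart R X n 0 ≤ ⊥) hx
    rintro _ ⟨α, β, A, h1, h2, rfl⟩
    lia

theorem eq_zero_of_mem_boundedPart {n : ℤ} {N : ℕ} {x : UnitalAlgebra R X}
    (hx : x ∈ boundedPart R X n N) (h : hX.rep R x = 0) : x = 0 := by
  induction N generalizing n x with
  | zero => exact eq_zero_of_mem_boundedPart_zero hX hx h
  | succ N ih =>
    obtain ⟨D, h1, h2⟩ := exists_mul_p_mem_boundedPart hX hx
    have h3 : x * p R X D = x := h2 x fun a => ih (mul_s_mem_boundedPart hX hx a) (by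
      rw [map_mul, h, zero_mul])
    rw [h3] at h1
    exact eq_zero_of_mem_boundedPart_zero hX h1 h

theorem eq_zero_of_mem_degreePart {n : ℤ} {x : UnitalAlgebra R X}
    (hx : x ∈ degreePart R X n) (h : hX.rep R x = 0) : x = 0 := by
  obtain ⟨N, hx⟩ := (mem_degreePart_iff hX).1 hx
  exact eq_zero_of_mem_boundedPart hX hx h

/-- The matrix entries of an element of degree n are scalar multiples of T^n; this is the purpose of
the variable T. -/
theorem rep_coeff_eq_zero {n : ℤ} {x : UnitalAlgebra R X} (hx : x ∈ degreePart R X n) (w z : X)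
    {k : ℤ} (hk : k ≠ n) : (hX.rep R x (single w 1) z).coeff k = 0 := by
  induction hx using Submodule.span_induction with
  | mem x hx =>
    obtain ⟨α, -, β, -, A, rfl, rfl⟩ := hx
    by_cases h : w ∈ img β (A : Set X)
    · obtain ⟨x, hx, h⟩ := h
      rw [rep_monomial_single hX α hx h]
      by_cases h' : α ++ₛ (x : Stream' 𝒜) ∈ X
      · classical
        rw [vec_of_mem h', single_apply]
        split_ifs
        · rw [mul_one, T_apply, if_neg hk.symm]
        · rfl
      · rw [vec_of_notMem h']
        rfl
    · rw [rep_monomial_single_of_notMem hX α h]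
      rfl
  | zero => rw [map_zero]; rfl
  | add x y _ _ hx hy =>
    rw [map_add, LinearMap.add_apply, Finsupp.add_apply, AddMonoidAlgebra.coeff_add,
      Finsupp.add_apply, hx, hy, add_zero]
  | smul r x _ hx =>
    rw [map_smul, LinearMap.smul_apply, Finsupp.smul_apply, AddMonoidAlgebra.coeff_smul,
      Finsupp.smul_apply, hx, smul_zero]

theorem eq_zero_of_rep_sum_eq_zero {ι : Finset ℤ} {x : ℤ → UnitalAlgebra R X}
    (hx : ∀ n, x n ∈ degreePart R X n) (h : hX.rep R (∑ n ∈ ι, x n) = 0) {n : ℤ} (hn : n ∈ ι) :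
    x n = 0 := by
  refine eq_zero_of_mem_degreePart hX (hx n) (Finsupp.lhom_ext' fun w => LinearMap.ext_ring ?_)
  change hX.rep R (x n) (single w 1) = 0
  refine Finsupp.ext fun z => LaurentPolynomial.ext fun k => ?_
  by_cases hk : k = n
  · subst hk
    have h1 : (hX.rep R (∑ n ∈ ι, x n) (single w 1) z).coeff k = 0 := by rw [h]; rfl
    rw [map_sum, LinearMap.sum_apply, Finsupp.finsetSum_apply, AddMonoidAlgebra.coeff_sum,
      Finsupp.finsetSum_apply, Finset.sum_eq_single k] at h1
    · exact h1
    · exact fun m _ hm => rep_coeff_eq_zero hX (hx m) w z hm.symm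
    · exact fun h => absurd hn h
  · exact rep_coeff_eq_zero hX (hx n) w z hk

theorem isInternal_degreePart : DirectSum.IsInternal (degreePart R X) := by
  classical
  constructor
  · have key (f : DirectSum ℤ fun n => degreePart R X n) (s : Finset ℤ)
        (hs : DFinsupp.support f ⊆ s) :
        DirectSum.coeAddMonoidHom (degreePart R X) f = ∑ n ∈ s, (f n : UnitalAlgebra R X) := by
      rw [DirectSum.coeAddMonoidHom_eq_dfinsuppSum, DFinsupp.sum]
      refine Finset.sum_subset hs fun n _ hn => ?_
      rw [DFinsupp.notMem_support_iff.1 hn]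
      rfl
    intro f g hfg
    rw [key f _ Finset.subset_union_left, key g _ Finset.subset_union_right, ← sub_eq_zero,
      ← Finset.sum_sub_distrib] at hfg
    refine DFinsupp.ext fun n => ?_
    by_cases hn : n ∈ DFinsupp.support f ∪ DFinsupp.support g
    · exact Subtype.ext (sub_eq_zero.1 (eq_zero_of_rep_sum_eq_zero hX
        (fun n => sub_mem (f n).2 (g n).2) (by rw [hfg, map_zero]) hn))
    · rw [Finset.mem_union, not_or, DFinsupp.notMem_support_iff, DFinsupp.notMem_support_iff] at hn
      exact hn.1.trans hn.2.symm
  · intro x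
    induction mem_span_monomials hX x using Submodule.span_induction with
    | mem x hx =>
      obtain ⟨α, β, A, rfl⟩ := hx
      exact ⟨DirectSum.of (fun n => degreePart R X n) _ ⟨_, monomial_mem_degreePart hX rfl⟩,
        DirectSum.coeAddMonoidHom_of _ _ _⟩
    | zero => exact ⟨0, map_zero _⟩
    | add x y _ _ hx hy =>
      obtain ⟨f, rfl⟩ := hx
      obtain ⟨g, rfl⟩ := hy
      exact ⟨f + g, map_add _ _ _⟩
    | smul r x _ hx =>
      obtain ⟨f, rfl⟩ := hx
      exact ⟨r • f, map_smul (DirectSum.coeLinearMap (degreePart R X)) r f⟩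

/-- The grading of the unital subshift algebra by the submodules `degreePart`. -/
noncomputable abbrev gradedAlgebra : GradedAlgebra (degreePart R X) :=
  { gradedMonoid_degreePart hX, (isInternal_degreePart hX).chooseDecomposition with }

theorem rep_injective : Function.Injective (hX.rep R) := by
  classical
  refine (injective_iff_map_eq_zero _).2 fun x hx => ?_
  obtain ⟨f, rfl⟩ := (isInternal_degreePart hX).2 x
  rw [DirectSum.coeAddMonoidHom_eq_dfinsuppSum, DFinsupp.sum] at hx ⊢
  exact Finset.sum_eq_zero fun n hn => eq_zero_of_rep_sum_eq_zero hX (fun n => (f n).2) hx hn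

end Faithful
end UnitalAlgebra
end Subshift

theorem Finsupp.map_eq_map_single {ι L N : Type*} [Semiring L] [AddCommMonoid N] [Module L N]
    (D : (ι →₀ L) →ₗ[L] N) (v : ι →₀ L) (i : ι)
    (h : ∀ j ∈ v.support, j ≠ i → D (Finsupp.single j 1) = 0) :
    D v = D (Finsupp.single i (v i)) := by
  classical
  nth_rewrite 1 [← Finsupp.sum_single v]
  rw [Finsupp.sum, map_sum, Finset.sum_eq_single i]
  · intro j hj hji
    rw [← mul_one (v j), ← smul_eq_mul, ← Finsupp.smul_single, map_smul, h j hj hji, smul_zero]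
  · intro hi
    rw [Finsupp.notMem_support_iff.1 hi, Finsupp.single_zero, map_zero]

/-! ### Irrational points and separation by cylinders -/

namespace Subshift

section Irrational

variable {𝒜 : Type u} {X : Set (Stream' 𝒜)}

/-- A sequence is irrational if all its shifts are different. -/
def IsIrrational (x : Stream' 𝒜) : Prop :=
  Function.Injective fun i : ℕ => x.drop i

theorem IsIrrational.drop {x : Stream' 𝒜} (hx : IsIrrational x) (n : ℕ) :
    IsIrrational (x.drop n) := by
  intro i j h
  simp only [Stream'.drop_drop] at h
  exact Nat.add_left_cancel (hx h)

theorem eq_cycle_of_eq_append {x : Stream' 𝒜} {γ : List 𝒜} (hγ : γ ≠ []) (h : x = γ ++ₛ x) :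
    x = Stream'.cycle γ hγ := by
  refine Stream'.ext fun n => ?_
  induction n using Nat.strong_induction_on with
  | _ n ih =>
    rw [h, Stream'.cycle_eq]
    rcases lt_or_ge n γ.length with hn | hn
    · rw [Stream'.get_append_left _ _ _ hn, Stream'.get_append_left _ _ _ hn]
    · obtain ⟨m, rfl⟩ := Nat.exists_eq_add_of_le hn
      rw [Stream'.get_append_right, Stream'.get_append_right]
      exact ih m (Nat.lt_add_of_pos_left (List.length_pos_iff.2 hγ))

/-- Two shifts of x coincide exactly when x is eventually periodic; the words involved are blocks of
x, hence in the language. -/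
theorem Admissible.isIrrational_iff (hX : Admissible X) {x : Stream' 𝒜} (hx : x ∈ X) :
    IsIrrational x ↔ ∀ α ∈ language X, ∀ β ∈ language X, ∀ hβ : β ≠ [],
      x ≠ α ++ₛ Stream'.cycle β hβ := by
  constructor
  · rintro h α - β - hβ rfl
    have h1 : (α ++ₛ Stream'.cycle β hβ).drop α.length =
        (α ++ₛ Stream'.cycle β hβ).drop (α.length + β.length) := by
      rw [← Stream'.drop_drop, Stream'.drop_append_stream]
      conv_rhs => rw [Stream'.cycle_eq, Stream'.drop_append_stream]
    exact hβ (List.length_eq_zero_iff.1 (Nat.left_eq_add.1 (h h1)))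
  · intro h
    have key (i j : ℕ) (hij : i < j) : x.drop i ≠ x.drop j := by
      intro h1
      obtain ⟨k, rfl⟩ := Nat.exists_eq_add_of_lt hij
      have hγ : (x.drop i).take (k + 1) ≠ [] := by
        rw [← List.length_pos_iff, Stream'.length_take]
        exact k.succ_pos
      refine h (x.take i) (take_mem_language hx i) _ (take_mem_language (hX.drop_mem hx i) (k + 1))
        hγ ?_
      rw [← eq_cycle_of_eq_append (x := x.drop i) hγ, Stream'.append_take_drop]
      conv_lhs => rw [← Stream'.append_take_drop (k + 1) (x.drop i)]
      rw [Stream'.drop_drop, ← Nat.add_assoc, ← h1]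
    intro i j hij
    rcases lt_trichotomy i j with h1 | h1 | h1
    · exact absurd hij (key i j h1)
    · exact h1
    · exact absurd hij.symm (key j i h1)

theorem Admissible.mem_irrationalPaths_iff (hX : Admissible X) {A : boolAlg X} :
    A ∈ irrationalPaths X ↔ ∃ x : X, (A : Set X) = {x} ∧ IsIrrational (x : Stream' 𝒜) :=
  exists_congr fun x => and_congr_right fun _ => (hX.isIrrational_iff x.2).symm

theorem exists_take_ne {x y : Stream' 𝒜} (h : x ≠ y) : ∃ n, x.take n ≠ y.take n := by
  by_contra! h'
  exact h (Stream'.take_theorem _ _ h')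

theorem Admissible.mem_imgMem_take (hX : Admissible X) (n : ℕ) (x z : X) :
    z ∈ (hX.imgMem ((x : Stream' 𝒜).take n) ⊤ : Set X) ↔
      (z : Stream' 𝒜).take n = (x : Stream' 𝒜).take n := by
  have := hX.mem_img_univ_iff ((x : Stream' 𝒜).take n) z
  rwa [Stream'.length_take] at this

theorem Admissible.exists_separating (hX : Admissible X) {x z : X} (h : z ≠ x) :
    ∃ A : boolAlg X, x ∈ (A : Set X) ∧ z ∉ (A : Set X) := by
  obtain ⟨n, hn⟩ := exists_take_ne fun h' => h (Subtype.ext h')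
  exact ⟨hX.imgMem ((x : Stream' 𝒜).take n) ⊤, (hX.mem_imgMem_take n x x).2 rfl,
    fun h' => hn ((hX.mem_imgMem_take n x z).1 h')⟩

theorem Admissible.exists_separating_finset (hX : Admissible X) (x : X) (s : Finset X) :
    ∃ A : boolAlg X, x ∈ (A : Set X) ∧ ∀ z ∈ s, z ≠ x → z ∉ (A : Set X) := by
  classical
  induction s using Finset.induction_on with
  | empty => exact ⟨⊤, trivial, by simp⟩
  | insert z s _ ih =>
    obtain ⟨A, h1, h2⟩ := ih
    by_cases h : z = x
    · refine ⟨A, h1, fun w hw hwx => ?_⟩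
      rcases Finset.mem_insert.1 hw with rfl | hw
      · exact absurd h hwx
      · exact h2 w hw hwx
    · obtain ⟨B, h3, h4⟩ := hX.exists_separating h
      refine ⟨A ⊓ B, ⟨h1, h3⟩, fun w hw hwx h5 => ?_⟩
      rcases Finset.mem_insert.1 hw with rfl | hw
      · exact h4 h5.2
      · exact h2 w hw hwx h5.1

end Irrational

namespace UnitalAlgebra

/-! ### Matrix coefficients of the representation -/

section Coefficients

open Finsupp LaurentPolynomial

variable {𝒜 : Type u} {R : Type v} [CommRing R] {X : Set (Stream' 𝒜)} (hX : Admissible X)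
include hX

theorem rep_ext {b c : UnitalAlgebra R X}
    (h : ∀ x, hX.rep R b (single x 1) = hX.rep R c (single x 1)) : b = c :=
  rep_injective hX (Finsupp.lhom_ext' fun x => LinearMap.ext_ring (h x))

theorem rep_p_apply_of_mem {A : boolAlg X} {z : X} (hz : z ∈ (A : Set X)) (v : RepModule R X) :
    hX.rep R (p R X A) v z = v z := by
  induction v using Finsupp.induction_linear with
  | zero => rw [map_zero]
  | add v w hv hw => rw [map_add, Finsupp.add_apply, Finsupp.add_apply, hv, hw]
  | single w m =>
    by_cases hw : w ∈ (A : Set X)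
    · rw [rep_p_single_of_mem hX hw]
    · rw [rep_p_single_of_notMem hX hw, single_eq_of_ne fun h => hw (by rwa [← h])]
      rfl

/-- A monomial only exchanges one prefix for another, so it connects only points with a common tail.
-/
theorem exists_drop_eq_drop {b : UnitalAlgebra R X} {x z : X}
    (h : hX.rep R b (single x 1) z ≠ 0) :
    ∃ i j, (x : Stream' 𝒜).drop i = (z : Stream' 𝒜).drop j := by
  by_contra! h'
  refine h ?_
  induction mem_span_monomials hX b using Submodule.span_induction with
  | mem b hb =>
    obtain ⟨α, β, A, rfl⟩ := hb
    by_cases hx : x ∈ img β (A : Set X)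
    · obtain ⟨y, hy, hx⟩ := hx
      rw [rep_monomial_single hX α hy hx]
      by_cases hz : α ++ₛ (y : Stream' 𝒜) ∈ X
      · rw [vec_of_mem hz, single_eq_of_ne]
        rintro rfl
        refine h' β.length α.length ?_
        rw [hx, Stream'.drop_append_stream, Stream'.drop_append_stream]
      · rw [vec_of_notMem hz]
        rfl
    · rw [rep_monomial_single_of_notMem hX α hx]
      rfl
  | zero => rw [map_zero]; rfl
  | add b c _ _ hb hc =>
    by_cases hb' : hX.rep R b (single x 1) z = 0
    · by_cases hc' : hX.rep R c (single x 1) z = 0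
      · rw [map_add, LinearMap.add_apply, Finsupp.add_apply, hb', hc', add_zero]
      · exact absurd (hc hc') hc'
    · exact absurd (hb hb') hb'
  | smul r b _ hb =>
    by_cases hb' : hX.rep R b (single x 1) z = 0
    · rw [map_smul, LinearMap.smul_apply, Finsupp.smul_apply, hb', smul_zero]
    · exact absurd (hb hb') hb'

/-- If a monomial maps e_y to a multiple of itself, irrationality forces α = β, so the multiplier is
1 and stays 1 nearby. Otherwise its diagonal coefficient is 0 near y. In particular no power of T
appears. -/
theorem exists_local_coeff {y : X} (hy : IsIrrational (y : Stream' 𝒜)) (b : UnitalAlgebra R X) :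
    ∃ (U : boolAlg X) (r : R), y ∈ (U : Set X) ∧
      ∀ v ∈ (U : Set X), hX.rep R b (single v 1) v = C r := by
  induction mem_span_monomials hX b using Submodule.span_induction with
  | mem b hb =>
    obtain ⟨α, β, A, rfl⟩ := hb
    by_cases hx : y ∈ img β (A : Set X)
    · obtain ⟨x, hxA, hyx⟩ := id hx
      by_cases hα : (y : Stream' 𝒜) = α ++ₛ (x : Stream' 𝒜)
      · have hl : α.length = β.length := hy (by
          change (y : Stream' 𝒜).drop _ = (y : Stream' 𝒜).drop _
          nth_rewrite 1 [hα]
          rw [hyx, Stream'.drop_append_stream, Stream'.drop_append_stream])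
        obtain rfl : α = β := Stream'.append_left_injective _ _ _ _ (hα.symm.trans hyx) hl
        refine ⟨hX.imgMem α A, 1, hx, ?_⟩
        rintro v ⟨x', hx', hv⟩
        rw [rep_monomial_single hX α hx' hv, ← hv, vec_coe, single_eq_same, sub_self, T_zero,
          mul_one, map_one]
      · obtain ⟨n, hn⟩ := exists_take_ne hα
        -- Agreement with y = βx on |β| + n letters makes x' agree with x on n letters; thus αx' and
        -- v = βx' still differ within the first n letters.
        refine ⟨hX.imgMem β A ⊓ hX.imgMem ((y : Stream' 𝒜).take (β.length + n)) ⊤, 0,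
          ⟨hx, (hX.mem_imgMem_take _ y y).2 rfl⟩, ?_⟩
        rintro v ⟨⟨x', hx', hv⟩, hv'⟩
        have hv' : (v : Stream' 𝒜).take _ = _ := (hX.mem_imgMem_take _ y v).1 hv'
        rw [rep_monomial_single hX α hx' hv, map_zero]
        by_cases h : α ++ₛ (x' : Stream' 𝒜) ∈ X
        · rw [vec_of_mem h, single_eq_of_ne]
          rintro h'
          have h' : (v : Stream' 𝒜) = α ++ₛ (x' : Stream' 𝒜) := congrArg Subtype.val h'
          apply hn
          have h1 : (x' : Stream' 𝒜).take n = (x : Stream' 𝒜).take n := by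
            rw [hv, hyx, ← Stream'.append_take, ← Stream'.append_take] at hv'
            exact List.append_cancel_left hv'
          have h2 (w : Stream' 𝒜) (γ : List 𝒜) :
              (γ ++ₛ w).take n = (γ ++ w.take n).take n := by
            rw [Stream'.append_take, Stream'.take_take, min_eq_right (Nat.le_add_left _ _)]
          have h3 := congrArg (List.take n) hv'
          rw [Stream'.take_take, Stream'.take_take, min_eq_right (Nat.le_add_left _ _)] at h3
          rw [← h3, h', h2, h1, ← h2]
        · rw [vec_of_notMem h]
          rfl
    · refine ⟨(hX.imgMem β A)ᶜ, 0, hx, fun v hv => ?_⟩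
      rw [rep_monomial_single_of_notMem hX α hv, map_zero]
      rfl
  | zero => exact ⟨⊤, 0, trivial, fun v _ => by rw [map_zero, map_zero]; rfl⟩
  | add b c _ _ hb hc =>
    obtain ⟨U, r, h1, h2⟩ := hb
    obtain ⟨U', r', h1', h2'⟩ := hc
    refine ⟨U ⊓ U', r + r', ⟨h1, h1'⟩, fun v hv => ?_⟩
    rw [map_add, LinearMap.add_apply, Finsupp.add_apply, h2 v hv.1, h2' v hv.2, map_add]
  | smul c b _ hb =>
    obtain ⟨U, r, h1, h2⟩ := hb
    refine ⟨U, c * r, h1, fun v hv => ?_⟩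
    rw [map_smul, LinearMap.smul_apply, Finsupp.smul_apply, h2 v hv, map_mul, smul_eq_C_mul]

theorem mul_p_eq_mul_p {A : boolAlg X} {x : X} (hA : (A : Set X) = {x}) {b c : UnitalAlgebra R X}
    (h : hX.rep R b (single x 1) = hX.rep R c (single x 1)) : b * p R X A = c * p R X A := by
  refine rep_ext hX fun w => ?_
  rw [map_mul, map_mul, Module.End.mul_apply, Module.End.mul_apply]
  by_cases hw : w = x
  · subst hw
    rw [rep_p_single_of_mem hX (by rw [hA]; rfl), h]
  · rw [rep_p_single_of_notMem hX (by rw [hA]; exact hw), map_zero, map_zero]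

theorem p_ne_zero [Nontrivial R] {A : boolAlg X} {x : X} (hx : x ∈ (A : Set X)) :
    p R X A ≠ 0 := by
  intro h
  have h1 := rep_p_single_of_mem (R := R) hX hx 1
  rw [h, map_zero, LinearMap.zero_apply, eq_comm, single_eq_zero] at h1
  exact one_ne_zero h1

end Coefficients

/-! ### Irrational one-point sets give minimal left ideals -/

section Socle

open Finsupp LaurentPolynomial

variable {𝒜 : Type u} {R : Type v} [Field R] {X : Set (Stream' 𝒜)} (hX : Admissible X)
include hX

theorem exists_mul_mul_p_eq {A : boolAlg X} {x : X} (hA : (A : Set X) = {x})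
    (hx : IsIrrational (x : Stream' 𝒜)) {b : UnitalAlgebra R X} (hb : b * p R X A ≠ 0) :
    ∃ d, d * (b * p R X A) = p R X A := by
  have hxA : x ∈ (A : Set X) := by rw [hA]; rfl
  have h1 : hX.rep R b (single x 1) ≠ 0 := fun h => hb <| by
    rw [mul_p_eq_mul_p hX hA (c := 0) (by rw [h, map_zero, LinearMap.zero_apply]), zero_mul]
  obtain ⟨z, hz⟩ := Finsupp.ne_iff.1 h1
  obtain ⟨i, j, hij⟩ := exists_drop_eq_drop hX hz
  obtain ⟨y, hy⟩ : ∃ y : X, (y : Stream' 𝒜) = (x : Stream' 𝒜).drop i :=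
    ⟨⟨_, hX.drop_mem x.2 i⟩, rfl⟩
  have hxy : (x : Stream' 𝒜) = (x : Stream' 𝒜).take i ++ₛ (y : Stream' 𝒜) := by
    rw [hy, Stream'.append_take_drop]
  have hzy : (z : Stream' 𝒜) = (z : Stream' 𝒜).take j ++ₛ (y : Stream' 𝒜) := by
    rw [hy, hij, Stream'.append_take_drop]
  set β := (x : Stream' 𝒜).take i
  set α := (z : Stream' 𝒜).take j
  -- This d carries e_z back to a multiple of e_x and kills every other basis vector.
  set d := p R X A * (s R X β * p R X ⊤ * sStar R X α) with hd
  have hdz (m : LaurentPolynomial R) : hX.rep R d (single z m) =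
      single x (T ((β.length : ℤ) - α.length) * m) := by
    rw [hd, map_mul, Module.End.mul_apply, rep_monomial_single hX β (A := ⊤) (x := y) trivial hzy,
      ← hxy, vec_coe, rep_p_single_of_mem hX hxA]
  have hd0 (w : X) (hw : w ≠ z) : hX.rep R d (single w 1) = 0 := by
    rw [hd, map_mul, Module.End.mul_apply]
    by_cases h : w ∈ img α ((⊤ : boolAlg X) : Set X)
    · obtain ⟨x', hx', hwx'⟩ := h
      rw [rep_monomial_single hX β hx' hwx']
      by_cases h' : β ++ₛ (x' : Stream' 𝒜) ∈ X
      · rw [vec_of_mem h', rep_p_single_of_notMem]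
        rw [hA]
        intro h2
        have h2 : β ++ₛ (x' : Stream' 𝒜) = x := congrArg Subtype.val h2
        rw [hxy] at h2
        exact hw (Subtype.ext (by rw [hwx', hzy, Stream'.append_right_injective _ _ _ h2]))
      · rw [vec_of_notMem h', map_zero]
    · rw [rep_monomial_single_of_notMem hX β h, map_zero]
  have hdb := Finsupp.map_eq_map_single (hX.rep R d) (hX.rep R b (single x 1)) z
    fun w _ hw => hd0 w hw
  rw [hdz, ← Module.End.mul_apply, ← map_mul] at hdb
  -- Irrationality makes the coefficient of db at x a scalar r, and R being a field makes it
  -- invertible.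
  obtain ⟨U, r, hU, hr⟩ := exists_local_coeff hX hx (d * b)
  have hr' := hr x hU
  rw [hdb, single_eq_same] at hr'
  rw [hr'] at hdb
  have hr0 : r ≠ 0 := by
    rintro rfl
    rw [map_zero] at hr'
    exact hz (((isUnit_T _).mul_right_eq_zero).1 hr')
  refine ⟨r⁻¹ • d, ?_⟩
  rw [smul_mul_assoc, ← mul_assoc, ← smul_mul_assoc]
  nth_rewrite 2 [← one_mul (p R X A)]
  refine mul_p_eq_mul_p hX hA ?_
  rw [map_smul, LinearMap.smul_apply, hdb, map_one, Module.End.one_apply, smul_single,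
    smul_eq_C_mul, ← map_mul, inv_mul_cancel₀ hr0, map_one]

theorem p_mul_mem_leftSocle {A : boolAlg X} (hA : A ∈ irrationalPaths X)
    (c : UnitalAlgebra R X) : p R X A * c ∈ leftSocle (UnitalAlgebra R X) := by
  obtain ⟨x, hA, hx⟩ := hX.mem_irrationalPaths_iff.1 hA
  by_cases h : p R X A * c = 0
  · rw [h]; exact zero_mem _
  have hI : IsAtom (Ideal.span {p R X A * c}) := by
    refine ⟨fun h' => h (Ideal.span_singleton_eq_bot.1 h'), fun J hJ => ?_⟩
    by_contra hJ0
    obtain ⟨j, hj, hj0⟩ := Submodule.exists_mem_ne_zero_of_ne_bot hJ0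
    obtain ⟨b, rfl⟩ := Ideal.mem_span_singleton'.1 (hJ.le hj)
    have hb : b * p R X A ≠ 0 := fun h' => hj0 (by rw [← mul_assoc, h', zero_mul])
    obtain ⟨d, hd⟩ := exists_mul_mul_p_eq hX hA hx hb
    refine hJ.not_ge ((Ideal.span_singleton_le_iff_mem _).2 ?_)
    have := J.mul_mem_left d hj
    rwa [← mul_assoc b, ← mul_assoc d, hd] at this
  exact (le_sSup hI : _ ≤ leftSocle _) (Ideal.subset_span rfl)

/-! ### Minimal left ideals come from irrational one-point sets -/

variable {I : Ideal (UnitalAlgebra R X)}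

omit hX in
theorem le_span_singleton_of_isAtom (hI : IsAtom I) {b : UnitalAlgebra R X}
    (hb : b ∈ I) (hb0 : b ≠ 0) : I ≤ Ideal.span {b} := by
  by_contra h
  have h1 : Ideal.span {b} ≤ I := (Ideal.span_singleton_le_iff_mem _).2 hb
  exact hb0 (Ideal.span_singleton_eq_bot.1 (hI.2 _ (lt_of_le_not_ge h1 h)))

/-- The vector b e_w has finite support, so a set A ∈ 𝒰 isolates one of its points, and p_A b stays
in I. -/
theorem exists_rep_eq_single_of_isAtom (hI : IsAtom I) :
    ∃ b ∈ I, ∃ (w z : X) (f : LaurentPolynomial R), f ≠ 0 ∧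
      hX.rep R b (single w 1) = single z f := by
  obtain ⟨b, hb, hb0⟩ := Submodule.exists_mem_ne_zero_of_ne_bot hI.1
  obtain ⟨w, hw⟩ : ∃ w, hX.rep R b (single w 1) ≠ 0 := by
    by_contra! h
    exact hb0 (rep_ext hX fun x => by rw [h, map_zero, LinearMap.zero_apply])
  obtain ⟨z, hz⟩ := Finsupp.ne_iff.1 hw
  obtain ⟨A, hzA, hA⟩ := hX.exists_separating_finset z (hX.rep R b (single w 1)).support
  refine ⟨p R X A * b, I.mul_mem_left _ hb, w, z, _, hz, ?_⟩
  rw [map_mul, Module.End.mul_apply,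
    Finsupp.map_eq_map_single (hX.rep R (p R X A)) _ z fun j hj hjz =>
      rep_p_single_of_notMem hX (hA j hj hjz) 1, rep_p_single_of_mem hX hzA]

/-- The elements of I that kill e_w form a left ideal properly inside I, hence zero, and cb is one
of them. -/
theorem mul_eq_zero_of_rep_eq_zero (hI : IsAtom I) {b : UnitalAlgebra R X} (hb : b ∈ I) {w z : X}
    {f : LaurentPolynomial R} (hf : f ≠ 0) (h : hX.rep R b (single w 1) = single z f)
    {c : UnitalAlgebra R X} (hc : hX.rep R c (single z 1) = 0) : c * b = 0 := by
  let K : Ideal (UnitalAlgebra R X) :=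
    { carrier := {i | i ∈ I ∧ hX.rep R i (single w 1) = 0}
      zero_mem' := ⟨zero_mem _, by rw [map_zero, LinearMap.zero_apply]⟩
      add_mem' := fun {i j} hi hj => ⟨add_mem hi.1 hj.1, by
        rw [map_add, LinearMap.add_apply, hi.2, hj.2, add_zero]⟩
      smul_mem' := fun d i hi => ⟨I.mul_mem_left d hi.1, by
        rw [smul_eq_mul, map_mul, Module.End.mul_apply, hi.2, map_zero]⟩ }
  have hK : K < I := by
    refine lt_of_le_not_ge (fun i hi => hi.1) fun hle => ?_
    have h1 : hX.rep R b (single w 1) = 0 := (hle hb).2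
    rw [h, single_eq_zero] at h1
    exact hf h1
  have hcb : c * b ∈ K := by
    refine ⟨I.mul_mem_left c hb, ?_⟩
    rw [map_mul, Module.End.mul_apply, h, ← mul_one f, ← smul_eq_mul, ← smul_single, map_smul,
      hc, smul_zero]
  rw [hI.2 K hK] at hcb
  exact hcb

theorem isIrrational_of_isAtom (hI : IsAtom I) {b : UnitalAlgebra R X} (hb : b ∈ I) {w z : X}
    {f : LaurentPolynomial R} (hf : f ≠ 0) (h : hX.rep R b (single w 1) = single z f) :
    IsIrrational (z : Stream' 𝒜) := by
  have key (i j : ℕ) (hij : i ≠ j) : (z : Stream' 𝒜).drop i ≠ (z : Stream' 𝒜).drop j := by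
    intro hd
    -- If the i-th and j-th shifts of z agree, u exchanges the two prefixes, fixing z but
    -- multiplying e_z by T^{j-i}.
    set u := s R X ((z : Stream' 𝒜).take j) * p R X ⊤ * sStar R X ((z : Stream' 𝒜).take i)
      with hu
    have huz : hX.rep R (u - 1) (single z f) = single z ((T ((j : ℤ) - i) - 1) * f) := by
      rw [map_sub, map_one, LinearMap.sub_apply, Module.End.one_apply, hu,
        rep_monomial_single hX _ (A := ⊤) (x := ⟨_, hX.drop_mem z.2 i⟩) trivial
          (Stream'.append_take_drop i _).symm]
      dsimp only
      rw [hd, Stream'.append_take_drop, vec_coe, Stream'.length_take, Stream'.length_take, sub_mul,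
        one_mul, single_sub]
    have hT : (T ((j : ℤ) - i) - 1 : LaurentPolynomial R) ≠ 0 := by
      intro h0
      have := congrArg (fun q : LaurentPolynomial R => q.coeff 0) (sub_eq_zero.1 h0)
      rw [← T_zero] at this
      simp only [T_apply] at this
      rw [if_neg (by lia)] at this
      simp at this
    have hb1 : hX.rep R ((u - 1) * b) (single w 1) = single z ((T ((j : ℤ) - i) - 1) * f) := by
      rw [map_mul, Module.End.mul_apply, h, huz]
    have hb0 : (u - 1) * b ≠ 0 := by
      intro h0
      rw [h0, map_zero, LinearMap.zero_apply, eq_comm, single_eq_zero] at hb1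
      exact mul_ne_zero hT hf hb1
    -- By minimality b is a left multiple of (u - 1)b, which makes T^{j-i} - 1 a unit; evaluation at
    -- T = 1 refutes this.
    obtain ⟨c, hc⟩ := Ideal.mem_span_singleton'.1
      (le_span_singleton_of_isAtom hI (I.mul_mem_left (u - 1) hb) hb0 hb)
    have h1 : hX.rep R c (hX.rep R ((u - 1) * b) (single w 1)) z = f := by
      rw [← Module.End.mul_apply, ← map_mul, hc, h, single_eq_same]
    rw [hb1, ← mul_one ((T ((j : ℤ) - i) - 1) * f), ← smul_eq_mul, ← smul_single, map_smul,
      Finsupp.smul_apply, smul_eq_mul] at h1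
    have h2 : (T ((j : ℤ) - i) - 1) * hX.rep R c (single z 1) z = 1 := by
      refine mul_left_cancel₀ hf ?_
      rw [mul_one, ← mul_assoc, mul_comm f, h1]
    have h3 := congrArg (eval₂ (RingHom.id R) 1) h2
    rw [map_mul, map_sub, map_one, eval₂_T, one_zpow, Units.val_one, sub_self, zero_mul] at h3
    exact zero_ne_one h3
  intro i j hij
  by_contra hne
  exact key i j hne hij

/-- The image of b lies in L e_z, so s_α^* b s_β has nonzero diagonal coefficient at y only. Local
constancy of that coefficient on U then forces U = {y}, and {z} is U with prefix α. -/
theorem exists_singleton_of_isAtom (hI : IsAtom I) {b : UnitalAlgebra R X} (hb : b ∈ I) {w z : X}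
    {f : LaurentPolynomial R} (hf : f ≠ 0) (h : hX.rep R b (single w 1) = single z f) :
    ∃ A : boolAlg X, (A : Set X) = {z} := by
  have hz := isIrrational_of_isAtom hX hI hb hf h
  have hrange (m : RepModule R X) : ∃ g, hX.rep R b m = single z g := by
    refine ⟨hX.rep R b m z, Finsupp.ext fun z' => ?_⟩
    by_cases hz' : z' = z
    · rw [hz', single_eq_same]
    -- With z' ∈ A and z ∉ A, the projection p_A kills e_z, hence p_A b = 0 and b has no coefficient
    -- at z'.
    · obtain ⟨A, h1, h2⟩ := hX.exists_separating (Ne.symm hz')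
      rw [single_eq_of_ne hz', ← rep_p_apply_of_mem hX h1 (hX.rep R b m), ← Module.End.mul_apply,
        ← map_mul, mul_eq_zero_of_rep_eq_zero hX hI hb hf h (rep_p_single_of_notMem hX h2 1),
        map_zero]
      rfl
  obtain ⟨i, j, hij⟩ := exists_drop_eq_drop hX (b := b) (x := w) (z := z)
    (by rwa [h, single_eq_same])
  obtain ⟨y, hy⟩ : ∃ y : X, (y : Stream' 𝒜) = (z : Stream' 𝒜).drop j :=
    ⟨⟨_, hX.drop_mem z.2 j⟩, rfl⟩
  have hwy : (w : Stream' 𝒜) = (w : Stream' 𝒜).take i ++ₛ (y : Stream' 𝒜) := by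
    rw [hy, ← hij, Stream'.append_take_drop]
  have hzy : (z : Stream' 𝒜) = (z : Stream' 𝒜).take j ++ₛ (y : Stream' 𝒜) := by
    rw [hy, Stream'.append_take_drop]
  set β := (w : Stream' 𝒜).take i
  set α := (z : Stream' 𝒜).take j
  obtain ⟨U, r, hyU, hU⟩ := exists_local_coeff hX (hy ▸ hz.drop j) (sStar R X α * b * s R X β)
  have hr : r ≠ 0 := by
    rintro rfl
    have h1 := hU y hyU
    rw [map_mul, map_mul, Module.End.mul_apply, Module.End.mul_apply, rep_s_single hX, ← hwy,
      vec_coe, ← smul_eq_mul, ← smul_single, map_smul, h, smul_single, smul_eq_mul,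
      rep_sStar_single hX hzy, single_eq_same, map_zero] at h1
    exact hf ((isUnit_T _).mul_right_eq_zero.1 ((isUnit_T _).mul_right_eq_zero.1 h1))
  refine ⟨hX.imgMem α U, Set.eq_singleton_iff_unique_mem.2 ⟨⟨y, hyU, hzy⟩, ?_⟩⟩
  rintro z' ⟨v, hv, hz'⟩
  have h1 := hU v hv
  obtain ⟨g, hg⟩ := hrange (hX.rep R (s R X β) (single v 1))
  rw [map_mul, map_mul, Module.End.mul_apply, Module.End.mul_apply, hg,
    rep_sStar_single hX hzy] at h1
  have hvy : v = y := by
    by_contra hne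
    rw [single_eq_of_ne hne] at h1
    have := congrArg (fun q : LaurentPolynomial R => q.coeff 0) h1
    simp only [C_apply, if_true] at this
    exact hr this.symm
  exact Subtype.ext (by rw [hz', hvy, hzy])

theorem le_of_isAtom (hI : IsAtom I) :
    I ≤ TwoSidedIdeal.asIdeal (TwoSidedIdeal.span (p R X '' irrationalPaths X)) := by
  obtain ⟨b, hb, w, z, f, hf, h⟩ := exists_rep_eq_single_of_isAtom hX hI
  obtain ⟨A, hA⟩ := exists_singleton_of_isAtom hX hI hb hf h
  have hz := isIrrational_of_isAtom hX hI hb hf h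
  have h1 : p R X Aᶜ * b = 0 := mul_eq_zero_of_rep_eq_zero hX hI hb hf h
    (rep_p_single_of_notMem hX (A := Aᶜ) (fun h' => h' (by rw [hA]; rfl)) 1)
  have hb0 : b ≠ 0 := by
    rintro rfl
    rw [map_zero, LinearMap.zero_apply, eq_comm, single_eq_zero] at h
    exact hf h
  rw [p_compl, sub_mul, one_mul, sub_eq_zero] at h1
  refine (le_span_singleton_of_isAtom hI hb hb0).trans
    ((Ideal.span_singleton_le_iff_mem _).2 ?_)
  rw [TwoSidedIdeal.mem_asIdeal, h1]
  exact TwoSidedIdeal.mul_mem_right _ _ _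
    (TwoSidedIdeal.subset_span ⟨A, hX.mem_irrationalPaths_iff.2 ⟨z, hA, hz⟩, rfl⟩)

/-! ### The socle: generators, homogeneity, nonvanishing, properness -/

omit hX in
theorem span_image_p_induction {S : Set (boolAlg X)} {P : UnitalAlgebra R X → Prop}
    (mul : ∀ A ∈ S, ∀ b c, P (b * (p R X A * c))) (zero : P 0)
    (add : ∀ b c, P b → P c → P (b + c)) (neg : ∀ b, P b → P (-b)) {b : UnitalAlgebra R X}
    (hb : b ∈ TwoSidedIdeal.span (p R X '' S)) : P b := by
  rw [TwoSidedIdeal.mem_span_iff_mem_addSubgroup_closure] at hb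
  induction hb using AddSubgroup.closure_induction with
  | mem b hb =>
    obtain ⟨_, ⟨b, -, _, ⟨A, hA, rfl⟩, rfl⟩, c, -, rfl⟩ := hb
    simp only [mul_assoc]
    exact mul A hA b c
  | zero => exact zero
  | add b c _ _ hb hc => exact add b c hb hc
  | neg b _ hb => exact neg b hb

theorem leftSocle_eq : leftSocle (UnitalAlgebra R X) =
    TwoSidedIdeal.asIdeal (TwoSidedIdeal.span (p R X '' irrationalPaths X)) := by
  refine le_antisymm (sSup_le fun I hI => le_of_isAtom hX hI) fun b hb => ?_
  exact span_image_p_induction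
    (fun A hA b c => Ideal.mul_mem_left _ b (p_mul_mem_leftSocle hX hA c)) (zero_mem _)
    (fun _ _ => add_mem) (fun _ => neg_mem) (TwoSidedIdeal.mem_asIdeal.1 hb)

/-- Exhibits homogeneous generators of the socle as a left ideal. -/
theorem leftSocle_eq_span : leftSocle (UnitalAlgebra R X) =
    Ideal.span {x | ∃ A ∈ irrationalPaths X, ∃ c ∈ monomials R X, x = p R X A * c} := by
  rw [leftSocle_eq hX]
  refine le_antisymm (fun b hb => ?_) (Ideal.span_le.2 ?_)
  · refine span_image_p_induction (P := fun b => b ∈ Ideal.span _) (fun A hA b c => Ideal.mul_mem_left _ b ?_) (zero_mem _)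
      (fun _ _ => add_mem) (fun _ => neg_mem) (TwoSidedIdeal.mem_asIdeal.1 hb)
    exact Submodule.mul_mem_of_mem_span' (R := R) (T := Submodule.restrictScalars R
      (Ideal.span {x | ∃ A ∈ irrationalPaths X, ∃ c ∈ monomials R X, x = p R X A * c}))
      (fun c hc => Ideal.subset_span ⟨A, hA, c, hc, rfl⟩) (mem_span_monomials hX c)
  · rintro _ ⟨A, hA, c, -, rfl⟩
    exact TwoSidedIdeal.mul_mem_right _ _ _ (TwoSidedIdeal.subset_span ⟨A, hA, rfl⟩)

theorem isHomogeneous_leftSocle :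
    ∃ _ : GradedAlgebra (degreePart R X),
      Ideal.IsHomogeneous (degreePart R X) (leftSocle (UnitalAlgebra R X)) := by
  refine ⟨gradedAlgebra hX, ?_⟩
  let _ := gradedAlgebra (R := R) hX
  rw [leftSocle_eq_span hX]
  refine Ideal.homogeneous_span _ _ ?_
  rintro _ ⟨A, -, _, ⟨α, β, B, rfl⟩, rfl⟩
  have hA := mul_p_mem_degreePart (R := R) hX (one_mem_degreePart hX) A
  rw [one_mul] at hA
  exact ⟨_, mul_mem_degreePart hX hA (monomial_mem_degreePart hX rfl)⟩

/-- For A = {x}, the image of b p_A c lies in the line spanned by b e_x, and a general element is a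
finite sum of such terms. -/
theorem exists_fg_range_le {b : UnitalAlgebra R X}
    (hb : b ∈ TwoSidedIdeal.span (p R X '' irrationalPaths X)) :
    ∃ N : Submodule (LaurentPolynomial R) (RepModule R X), N.FG ∧ ∀ m, hX.rep R b m ∈ N := by
  refine span_image_p_induction (P := fun b => ∃ N : Submodule (LaurentPolynomial R)
    (RepModule R X), N.FG ∧ ∀ m, hX.rep R b m ∈ N) (fun A hA b c => ?_) ?_ ?_ ?_ hb
  · obtain ⟨x, hA, -⟩ := hA
    refine ⟨Submodule.span _ {hX.rep R b (single x 1)}, Submodule.fg_span_singleton _, fun m => ?_⟩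
    rw [map_mul, map_mul, Module.End.mul_apply, Module.End.mul_apply,
      Finsupp.map_eq_map_single (hX.rep R (p R X A)) _ x fun j _ hj =>
        rep_p_single_of_notMem hX (by rw [hA]; exact hj) 1,
      rep_p_single_of_mem hX (by rw [hA]; rfl), ← mul_one (hX.rep R c m x), ← smul_eq_mul,
      ← smul_single, map_smul]
    exact Submodule.smul_mem _ _ (Submodule.subset_span rfl)
  · exact ⟨⊥, Submodule.fg_bot, fun m => by rw [map_zero]; exact zero_mem _⟩
  · rintro b c ⟨N, h1, h2⟩ ⟨N', h1', h2'⟩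
    refine ⟨N ⊔ N', h1.sup h1', fun m => ?_⟩
    rw [map_add]
    exact Submodule.add_mem_sup (h2 m) (h2' m)
  · rintro b ⟨N, h1, h2⟩
    refine ⟨N, h1, fun m => ?_⟩
    rw [map_neg]
    exact neg_mem (h2 m)

theorem leftSocle_ne_bot_iff :
    leftSocle (UnitalAlgebra R X) ≠ ⊥ ↔ (irrationalPaths X).Nonempty := by
  constructor
  · intro h
    by_contra h'
    rw [Set.not_nonempty_iff_eq_empty] at h'
    refine h ((Submodule.eq_bot_iff _).2 fun b hb => ?_)
    rw [leftSocle_eq hX, TwoSidedIdeal.mem_asIdeal] at hb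
    exact span_image_p_induction (P := fun b => b = 0) (fun A hA => absurd hA (by rw [h']; exact Set.notMem_empty A))
      rfl (fun b c hb hc => by rw [hb, hc, add_zero]) (fun b hb => by rw [hb, neg_zero]) hb
  · rintro ⟨A, hA⟩ h
    have h1 := p_mul_mem_leftSocle (R := R) hX hA 1
    rw [h, mul_one, Submodule.mem_bot] at h1
    obtain ⟨x, hx, -⟩ := hA
    exact p_ne_zero hX (x := x) (by rw [hx]; rfl) h1

theorem leftSocle_ne_top : leftSocle (UnitalAlgebra R X) ≠ ⊤ := by
  intro h
  obtain ⟨x₀, hx₀, -⟩ := hX.nil_mem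
  have h0 : (irrationalPaths X).Nonempty := by
    rw [← leftSocle_ne_bot_iff (R := R) hX, h]
    intro h'
    have h1 : (1 : UnitalAlgebra R X) ∈ (⊥ : Ideal (UnitalAlgebra R X)) := h' ▸ trivial
    rw [Submodule.mem_bot, ← p_top] at h1
    exact p_ne_zero hX (A := ⊤) (x := ⟨x₀, hx₀⟩) trivial h1
  obtain ⟨A, hA⟩ := h0
  obtain ⟨x, -, hx⟩ := hX.mem_irrationalPaths_iff.1 hA
  have h1 : (1 : UnitalAlgebra R X) ∈ leftSocle (UnitalAlgebra R X) := h ▸ trivial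
  rw [leftSocle_eq hX, TwoSidedIdeal.mem_asIdeal] at h1
  obtain ⟨N, h2, h3⟩ := exists_fg_range_le hX h1
  have hN : N = ⊤ := by
    refine eq_top_iff.2 fun m _ => ?_
    have := h3 m
    rwa [map_one] at this
  have : Module.Finite (LaurentPolynomial R) (RepModule R X) := ⟨hN ▸ h2⟩
  have hfin : Finite X := Module.Finite.finite_basis (R := LaurentPolynomial R)
    (Finsupp.basisSingleOne (ι := X))
  -- The shifts of an irrational point are infinitely many distinct elements of X.
  refine not_injective_infinite_finite
    (fun i : ℕ => (⟨_, hX.drop_mem x.2 i⟩ : X)) fun i j hij => hx (congrArg Subtype.val hij)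

end Socle
end UnitalAlgebra
end Subshift

theorem mainTheorem6 {𝒜 : Type u} [Nonempty 𝒜] {R : Type v} [Field R]
    (X : Set (Stream' 𝒜)) (hX : Subshift.IsSubshift X)
    (hletters : ∀ a : 𝒜, [a] ∈ Subshift.language X) :
    leftSocle (Subshift.UnitalAlgebra R X) =
        TwoSidedIdeal.asIdeal
          (TwoSidedIdeal.span (Subshift.UnitalAlgebra.p R X '' Subshift.irrationalPaths X)) ∧
      (∃ _ : GradedAlgebra (Subshift.UnitalAlgebra.degreePart R X),
        Ideal.IsHomogeneous (Subshift.UnitalAlgebra.degreePart R X)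
          (leftSocle (Subshift.UnitalAlgebra R X))) ∧
      (leftSocle (Subshift.UnitalAlgebra R X) ≠ ⊥ ↔ (Subshift.irrationalPaths X).Nonempty) ∧
      leftSocle (Subshift.UnitalAlgebra R X) ≠ ⊤ := by
  have h := hX.admissible hletters
  exact ⟨Subshift.UnitalAlgebra.leftSocle_eq h, Subshift.UnitalAlgebra.isHomogeneous_leftSocle h,
    Subshift.UnitalAlgebra.leftSocle_ne_bot_iff h, Subshift.UnitalAlgebra.leftSocle_ne_top h⟩
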